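/- **Theorem 3.** All graphs are finite, simple and undirected unless said otherwise. The *moral graph* of a directed acyclic graph $D=(V,A)$ is the undirected graph on $V$ in which distinct $u,v$ are adjacent if and only if $(u,v)\in A$, or $(v,u)\in A$, or $u$ and $v$ are parents of a common vertex ($(u,x),(v,x)\in A$ for some $x\in V$). A graph is *moral* if it is the moral graph of some directed acyclic graph. A vertex $x$ of a graph $G$ is *simplicial* if its neighbours $N_G(x)$ are pairwise adjacent; *eliminating* $x$ means passing to $G-x-E(G[N_G(x)])$, that is, deleting $x$ and all edges among its neighbours. The morality of graphs of maximum degree at most $3$ can be decided in polynomial time. More precisely, let $G=(V,E)$ be a graph with maximum degree $\Delta(G)\le 3$. Then: 1. if $G$ is moral and $x$ is a simplicial vertex of $G$, then $G-x-E(G[N_G(x)])$ is moral; 2. the procedure that, starting from $G$, repeatedly eliminates an arbitrary simplicial vertex of the current graph as long as there is one stops after at most $|V|$ eliminations, whatever choices are made; 3. whatever choices are made, the graph in which the procedure stops is the empty graph (the graph without vertices) if and only if $G$ is moral. Moreover, there is a Turing machine that, given the adjacency matrix of a graph $G$ on $\{0,\dots,n-1\}$ with $\Delta(G)\le 3$,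 outputs whether $G$ is moral, in a number of steps bounded by a polynomial in the length of the input. -/

import Mathlib

/-- A directed graph is acyclic if it has no directed cycle. -/
def Digraph.IsDAG {V : Type*} (D : Digraph V) : Prop :=
  ∀ v : V, ¬ Relation.TransGen D.Adj v v

/-- `uv` is a filled edge: `u` and `v` are distinct non-adjacent parents of a common vertex. -/
def Digraph.IsFilled {V : Type*} (D : Digraph V) (u v : V) : Prop :=
  u ≠ v ∧ ¬ D.Adj u v ∧ ¬ D.Adj v u ∧ ∃ x, D.Adj u x ∧ D.Adj v x

/-- The moral graph of a directed graph: the skeleton together with the filled edges. -/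
def Digraph.moralGraph {V : Type*} (D : Digraph V) : SimpleGraph V where
  Adj u v := u ≠ v ∧ (D.Adj u v ∨ D.Adj v u ∨ D.IsFilled u v)
  symm := ⟨by
    rintro u v ⟨h, h'⟩
    refine ⟨h.symm, ?_⟩
    rcases h' with h' | h' | ⟨-, h₁, h₂, x, h₃, h₄⟩
    · exact Or.inr (Or.inl h')
    · exact Or.inl h'
    · exact Or.inr (Or.inr ⟨h.symm, h₂, h₁, x, h₄, h₃⟩)⟩
  loopless := ⟨fun _ h => h.1 rfl⟩

namespace SimpleGraph

/-- A graph is moral if it is the moral graph of a directed acyclic graph. -/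
def IsMoral {V : Type*} (G : SimpleGraph V) : Prop :=
  ∃ D : Digraph V, D.IsDAG ∧ D.moralGraph = G

/-- `x` is a simplicial vertex of the graph `H` (whose vertex set is `H.verts`): the neighbours
of `x` in `H` are pairwise adjacent in `H`. -/
def Subgraph.IsSimplicial {V : Type*} {G : SimpleGraph V} (H : G.Subgraph) (x : V) : Prop :=
  x ∈ H.verts ∧ (H.neighborSet x).Pairwise H.Adj

/-- `H - x - E(H[N(x)])`: delete the vertex `x` and all edges among the neighbours of `x`. -/
def Subgraph.eliminate {V : Type*} {G : SimpleGraph V} (H : G.Subgraph) (x : V) : G.Subgraph :=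
  (H.deleteVerts {x}).deleteEdges (H.induce (H.neighborSet x)).edgeSet

/-- `ElimRun G k H`: starting from `G`, some choice of `k` successive eliminations of simplicial
vertices leads to the graph `H`. -/
inductive ElimRun {V : Type*} (G : SimpleGraph V) : ℕ → G.Subgraph → Prop
  | start : ElimRun G 0 ⊤
  | step {k : ℕ} {H : G.Subgraph} {x : V} :
      ElimRun G k H → H.IsSimplicial x → ElimRun G (k + 1) (H.eliminate x)

end SimpleGraph

/-- Inputs of the decision problem: graphs on `{0, …, n - 1}` of maximum degree at most three. -/
structure SubcubicGraph where
  n : ℕ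
  graph : SimpleGraph (Fin n)
  [decAdj : DecidableRel graph.Adj]
  maxDegree_le : graph.maxDegree ≤ 3

attribute [instance] SubcubicGraph.decAdj

/-- The adjacency matrix written row by row; each row is its sequence of bits (`some b`) followed
by an end-of-row mark (`none`). -/
def SubcubicGraph.encode (I : SubcubicGraph) : List (Option Bool) :=
  (List.ofFn fun i : Fin I.n =>
    (List.ofFn fun j : Fin I.n => some (decide (I.graph.Adj i j))) ++ [none]).flatten

open Classical in
/-- The answer to the decision problem: is the given graph moral? -/
noncomputable def SubcubicGraph.morality (I : SubcubicGraph) : Bool :=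
  decide I.graph.IsMoral

/-! Morality is invariant under elimination of a simplicial vertex `x`. If the smaller graph is
moral through `D`, adding arcs from all neighbours of `x` to `x` makes `x` a sink whose parents fill
exactly the deleted clique (`IsMoral.of_isolate`); no degree bound is needed. Conversely
(`IsMoral.isolate`), let `D` have moral graph `H`. If `x` has at most one neighbour, it has at most
one parent, so dropping the arcs at `x` loses no other edge. Otherwise the degree bound leaves each
vertex of the closed neighbourhood `S` of `x` at most one neighbour outside `S`. Drop the arcs
inside `S` and direct all edges between `S` and the rest into `S`: the vertices of `S` become sinks
with at most one parent, so no cycle arises and no edge is filled through `S`, neither before nor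
after.

A sink of an acyclic digraph has only parents as neighbours in the moral graph, so it is simplicial.
Hence a nonempty moral graph always admits an elimination, and a run can get stuck only at the empty
graph or at a graph that is not moral.

The algorithm works in rounds. Each takes a snapshot `H₀` of the graph and, for every vertex `x` in
turn, deletes the edges inside the closed neighbourhood of `x` in `H₀` if it is still a clique. Such
a clique is also the closed neighbourhood of `x` in the current graph, so each deletion is a genuine
elimination. A round removes an edge from every moral graph that has one; hence `n * n` rounds clear
exactly the moral graphs. A stack machine carries this out by sequential scans of the adjacency
matrix; its structured programs are verified together with step bounds. -/

namespace SimpleGraph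

/-! ### Elimination preserves and reflects morality -/

variable {V : Type*}

/-- `H` with all edges inside the closed neighbourhood of `x` deleted; this is the elimination
of `x`, except that `x` stays as an isolated vertex. -/
def isolate (H : SimpleGraph V) (x : V) : SimpleGraph V where
  Adj u v := H.Adj u v ∧ ¬ ((u = x ∨ H.Adj x u) ∧ (v = x ∨ H.Adj x v))
  symm := ⟨fun _ _ h => ⟨h.1.symm, fun h' => h.2 h'.symm⟩⟩
  loopless := ⟨fun _ h => h.1.ne rfl⟩

theorem not_isolate_adj (H : SimpleGraph V) (x u : V) : ¬ (H.isolate x).Adj x u :=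
  fun h => h.2 ⟨Or.inl rfl, Or.inr h.1⟩

theorem moralGraph_adj {D : Digraph V} {u v : V} : D.moralGraph.Adj u v ↔
    u ≠ v ∧ (D.Adj u v ∨ D.Adj v u ∨ ∃ x, D.Adj u x ∧ D.Adj v x) := by
  change (u ≠ v ∧ (D.Adj u v ∨ D.Adj v u ∨ D.IsFilled u v)) ↔ _
  unfold Digraph.IsFilled
  tauto

theorem _root_.Digraph.IsDAG.irrefl {D : Digraph V} (hD : D.IsDAG) (v : V) : ¬ D.Adj v v :=
  fun h => hD v (Relation.TransGen.single h)

theorem _root_.Digraph.IsDAG.ne {D : Digraph V} (hD : D.IsDAG) {u v : V} (h : D.Adj u v) :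
    u ≠ v := by
  rintro rfl
  exact hD.irrefl u h

/-- A digraph stays acyclic when its arcs are restricted and arcs into sinks are added. -/
theorem _root_.Digraph.IsDAG.of_sinks {D D' : Digraph V} (hD : D.IsDAG) (s : Set V)
    (hs : ∀ u ∈ s, ∀ v, ¬ D'.Adj u v) (h : ∀ u v, D'.Adj u v → v ∉ s → D.Adj u v) :
    D'.IsDAG := by
  intro v hv
  -- A walk ending outside `s` never visits `s`, since its inner vertices have outgoing arcs; so all
  -- its arcs lie in `D`.
  have key : ∀ a b, Relation.TransGen D'.Adj a b → b ∉ s → Relation.TransGen D.Adj a b := by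
    intro a b hab
    induction hab with
    | single hab => exact fun hb => .single (h _ _ hab hb)
    | tail _ hbc ih => exact fun hc => (ih fun hb => hs _ hb _ hbc).tail (h _ _ hbc hc)
  have hvs : v ∉ s := by
    intro hvs
    obtain ⟨w, hw, -⟩ := Relation.TransGen.head'_iff.1 hv
    exact hs v hvs w hw
  exact hD v (key v v hv hvs)

/-- Two parents of `x` would be two neighbours, so no edge is filled through `x` and the arcs at `x`
can simply be dropped. -/
theorem IsMoral.isolate_of_subsingleton {H : SimpleGraph V} {x : V}
    (hx : (H.neighborSet x).Subsingleton) (hH : H.IsMoral) : (H.isolate x).IsMoral := by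
  obtain ⟨D, hD, rfl⟩ := hH
  refine ⟨⟨fun u v => D.Adj u v ∧ u ≠ x ∧ v ≠ x⟩,
    hD.of_sinks ∅ (by simp) fun _ _ h _ => h.1, ?_⟩
  have hpar : ∀ u v, u ≠ v → D.Adj u x → ¬ D.Adj v x := fun u v huv hu hv =>
    huv (hx (show D.moralGraph.Adj x u from moralGraph_adj.2 ⟨(hD.ne hu).symm, by tauto⟩)
      (show D.moralGraph.Adj x v from moralGraph_adj.2 ⟨(hD.ne hv).symm, by tauto⟩))
  ext u v
  simp only [moralGraph_adj, isolate]
  constructor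
  · rintro ⟨huv, h⟩
    refine ⟨⟨huv, ?_⟩, ?_⟩
    · rcases h with h | h | ⟨w, h⟩
      · exact Or.inl h.1
      · exact Or.inr (Or.inl h.1)
      · exact Or.inr (Or.inr ⟨w, h.1.1, h.2.1⟩)
    · have hu : u ≠ x := by rcases h with h | h | ⟨w, h⟩ <;> tauto
      have hv : v ≠ x := by rcases h with h | h | ⟨w, h⟩ <;> tauto
      rintro ⟨hu' | hu', hv' | hv'⟩
      · exact hu hu'
      · exact hu hu'
      · exact hv hv'
      · exact huv (hx (moralGraph_adj.2 hu') (moralGraph_adj.2 hv'))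
  · rintro ⟨⟨huv, h⟩, h'⟩
    have hu : u ≠ x := by
      rintro rfl
      exact h' ⟨Or.inl rfl, Or.inr ⟨huv, h⟩⟩
    have hv : v ≠ x := by
      rintro rfl
      refine h' ⟨Or.inr ⟨huv.symm, ?_⟩, Or.inl rfl⟩
      rcases h with h | h | ⟨w, h⟩
      · exact Or.inr (Or.inl h)
      · exact Or.inl h
      · exact Or.inr (Or.inr ⟨w, h.2, h.1⟩)
    refine ⟨huv, ?_⟩
    rcases h with h | h | ⟨w, h⟩
    · exact Or.inl ⟨h, hu, hv⟩
    · exact Or.inr (Or.inl ⟨h, hv, hu⟩)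
    · have hw : w ≠ x := by
        rintro rfl
        exact hpar u v huv h.1 h.2
      exact Or.inr (Or.inr ⟨w, ⟨h.1, hu, hw⟩, h.2, hv, hw⟩)

/-- Arcs inside the closed neighbourhood `S` are dropped and all edges leaving `S` are directed into
it. Two parents outside `S` of a common vertex of `S` coincide, so filled edges outside `S` have
their common child outside `S`, in the old digraph as in the new one. -/
theorem IsMoral.isolate_of_forall_subsingleton {H : SimpleGraph V} {x : V}
    (hx : ∀ s, s = x ∨ H.Adj x s →
      {v | H.Adj s v ∧ ¬ (v = x ∨ H.Adj x v)}.Subsingleton)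
    (hH : H.IsMoral) : (H.isolate x).IsMoral := by
  obtain ⟨D, hD, rfl⟩ := hH
  set H := D.moralGraph with hHdef
  let S : Set V := {u | u = x ∨ H.Adj x u}
  have hS : ∀ s ∈ S, ∀ u v, H.Adj s u → H.Adj s v → u ∉ S → v ∉ S → u = v :=
    fun s hs u v hu hv hu' hv' => hx s hs ⟨hu, hu'⟩ ⟨hv, hv'⟩
  have hadj : ∀ {u v}, D.Adj u v → H.Adj u v := fun h => moralGraph_adj.2 ⟨hD.ne h, Or.inl h⟩
  refine ⟨⟨fun u v => u ∉ S ∧ (v ∉ S ∧ D.Adj u v ∨ v ∈ S ∧ H.Adj u v)⟩,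
    hD.of_sinks S (fun u hu v h => h.1 hu) (fun u v h hv => ?_), ?_⟩
  · rcases h.2 with h | h
    · exact h.2
    · exact absurd h.1 hv
  ext u v
  change _ ↔ H.Adj u v ∧ ¬ (u ∈ S ∧ v ∈ S)
  simp only [moralGraph_adj]
  constructor
  · rintro ⟨huv, h⟩
    rcases h with ⟨hu, ⟨hv, h⟩ | ⟨hv, h⟩⟩ | ⟨hv, ⟨hu, h⟩ | ⟨hu, h⟩⟩ |
      ⟨w, ⟨hu, ⟨hw, h⟩ | ⟨hw, h⟩⟩, ⟨hv, ⟨hw', h'⟩ | ⟨hw', h'⟩⟩⟩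
    · exact ⟨hadj h, by tauto⟩
    · exact ⟨h, by tauto⟩
    · exact ⟨(hadj h).symm, by tauto⟩
    · exact ⟨h.symm, by tauto⟩
    · exact ⟨moralGraph_adj.2 ⟨huv, Or.inr (Or.inr ⟨w, h, h'⟩)⟩, by tauto⟩
    · exact absurd hw' hw
    · exact absurd hw hw'
    · exact absurd (hS w hw u v h.symm h'.symm hu hv) huv
  · rintro ⟨h, huv⟩
    refine ⟨h.ne, ?_⟩
    by_cases hu : u ∈ S
    · exact Or.inr (Or.inl ⟨by tauto, Or.inr ⟨hu, h.symm⟩⟩)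
    by_cases hv : v ∈ S
    · exact Or.inl ⟨hu, Or.inr ⟨hv, h⟩⟩
    rcases (moralGraph_adj.1 h).2 with h' | h' | ⟨w, hw, hw'⟩
    · exact Or.inl ⟨hu, Or.inl ⟨hv, h'⟩⟩
    · exact Or.inr (Or.inl ⟨hv, Or.inl ⟨hu, h'⟩⟩)
    · by_cases hwS : w ∈ S
      · exact absurd (hS w hwS u v (hadj hw).symm (hadj hw').symm hu hv) h.ne
      · exact Or.inr (Or.inr ⟨w, ⟨hu, Or.inl ⟨hwS, hw⟩⟩, hv, Or.inl ⟨hwS, hw'⟩⟩)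

/-- No vertex has four distinct neighbours. -/
def IsSubcubic (H : SimpleGraph V) : Prop :=
  ∀ s : Finset V, ∀ v, (∀ u ∈ s, H.Adj v u) → s.card ≤ 3

theorem IsSubcubic.mono {H H' : SimpleGraph V} (h : H' ≤ H) (hH : H.IsSubcubic) :
    H'.IsSubcubic := fun s v hs => hH s v fun u hu => h (hs u hu)

theorem isSubcubic_of_maxDegree_le [Fintype V] (G : SimpleGraph V) [DecidableRel G.Adj]
    (h : G.maxDegree ≤ 3) : G.IsSubcubic := fun s v hs => by
  refine (Finset.card_le_card (t := G.neighborFinset v) fun u hu => ?_).trans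
    ((G.degree_le_maxDegree v).trans h)
  simpa using hs u hu

/-- Elimination of a simplicial vertex preserves morality in subcubic graphs. -/
theorem IsMoral.isolate {H : SimpleGraph V} (h3 : H.IsSubcubic) {x : V}
    (hx : H.IsClique (H.neighborSet x)) (hH : H.IsMoral) : (H.isolate x).IsMoral := by
  classical
  by_cases hsub : (H.neighborSet x).Subsingleton
  · exact hH.isolate_of_subsingleton hsub
  refine hH.isolate_of_forall_subsingleton ?_
  rintro s (rfl | hs)
  · rintro u ⟨hu, hu'⟩
    exact absurd (Or.inr hu) hu'
  · obtain ⟨t, ht, hts⟩ : ∃ t, H.Adj x t ∧ t ≠ s := by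
      by_contra! hcon
      exact hsub fun a ha b hb => (hcon a ha).trans (hcon b hb).symm
    rintro u ⟨hu, hu'⟩ v ⟨hv, hv'⟩
    -- Otherwise `s` has the four distinct neighbours `x`, `t`, `u`, `v`, the first two inside the
    -- closed neighbourhood of `x` and the last two outside.
    by_contra huv
    have := h3 {x, t, u, v} s (by
      intro w hw
      simp only [Finset.mem_insert, Finset.mem_singleton] at hw
      rcases hw with rfl | rfl | rfl | rfl
      · exact hs.symm
      · exact hx hs ht hts.symm
      · exact hu
      · exact hv)
    have hxt := ht.ne
    have h1 : x ≠ u := fun h => hu' (Or.inl h.symm)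
    have h2 : x ≠ v := fun h => hv' (Or.inl h.symm)
    have h4 : t ≠ u := fun h => hu' (Or.inr (h ▸ ht))
    have h5 : t ≠ v := fun h => hv' (Or.inr (h ▸ ht))
    have hcard : ({x, t, u, v} : Finset V).card = 4 := by
      simp [*]
    omega

/-- Elimination of a simplicial vertex reflects morality. -/
theorem IsMoral.of_isolate {H : SimpleGraph V} {x : V}
    (hx : H.IsClique (H.neighborSet x)) (hH : (H.isolate x).IsMoral) : H.IsMoral := by
  obtain ⟨D, hD, hDH⟩ := hH
  have hadj : ∀ {u v}, D.Adj u v → (H.isolate x).Adj u v := fun h => by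
    rw [← hDH]
    exact moralGraph_adj.2 ⟨hD.ne h, Or.inl h⟩
  have hxs : ∀ v, ¬ D.Adj x v := fun v h => H.not_isolate_adj x v (hadj h)
  have hxs' : ∀ v, ¬ D.Adj v x := fun v h => H.not_isolate_adj x v (hadj h).symm
  -- The vertex `x` is isolated in `D`; as a sink below all its neighbours it restores the whole
  -- clique.
  refine ⟨⟨fun u v => D.Adj u v ∨ v = x ∧ H.Adj x u⟩,
    hD.of_sinks {x} ?_ ?_, ?_⟩
  · rintro u rfl v (h | h)
    · exact hxs v h
    · exact H.irrefl h.2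
  · rintro u v (h | h) hv
    · exact h
    · exact absurd h.1 hv
  ext u v
  simp only [moralGraph_adj]
  constructor
  · rintro ⟨huv, (h | ⟨rfl, h⟩) | (h | ⟨rfl, h⟩) | ⟨w, h | ⟨rfl, h⟩, h' | ⟨h2, h'⟩⟩⟩
    · exact (hadj h).1
    · exact h.symm
    · exact (hadj h).1.symm
    · exact h
    · have : (H.isolate x).Adj u v := by
        rw [← hDH]
        exact moralGraph_adj.2 ⟨huv, Or.inr (Or.inr ⟨w, h, h'⟩)⟩
      exact this.1
    · exact absurd (h2 ▸ h) (hxs' u)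
    · exact absurd h' (hxs' v)
    · exact hx h h' huv
  · intro h
    refine ⟨h.ne, ?_⟩
    by_cases huv : (u = x ∨ H.Adj x u) ∧ (v = x ∨ H.Adj x v)
    · rcases huv with ⟨rfl | hu, rfl | hv⟩
      · exact absurd h H.irrefl
      · exact Or.inr (Or.inl (Or.inr ⟨rfl, hv⟩))
      · exact Or.inl (Or.inr ⟨rfl, hu⟩)
      · exact Or.inr (Or.inr ⟨x, Or.inr ⟨rfl, hu⟩, Or.inr ⟨rfl, hv⟩⟩)
    · have : (H.isolate x).Adj u v := ⟨h, huv⟩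
      rw [← hDH, moralGraph_adj] at this
      rcases this.2 with h | h | ⟨w, h, h'⟩
      · exact Or.inl (Or.inl h)
      · exact Or.inr (Or.inl (Or.inl h))
      · exact Or.inr (Or.inr ⟨w, Or.inl h, Or.inl h'⟩)

theorem isMoral_bot : (⊥ : SimpleGraph V).IsMoral := by
  refine ⟨⟨fun _ _ => False⟩, fun v hv => ?_, ?_⟩
  · obtain ⟨w, hw, -⟩ := Relation.TransGen.head'_iff.1 hv
    exact hw
  · ext u v
    simp [moralGraph_adj]

/-- A nonempty set of vertices closed under adjacency in a finite moral graph contains a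
simplicial vertex. -/
theorem IsMoral.exists_isClique_neighborSet [Finite V] {H : SimpleGraph V} (hH : H.IsMoral)
    {s : Set V} (hs : s.Nonempty) (hadj : ∀ u ∈ s, ∀ v, H.Adj u v → v ∈ s) :
    ∃ x ∈ s, H.IsClique (H.neighborSet x) := by
  obtain ⟨D, hD, rfl⟩ := hH
  have hwf : WellFounded (fun a b => Relation.TransGen D.Adj b a) := by
    have : IsTrans V (fun a b => Relation.TransGen D.Adj b a) := ⟨fun _ _ _ h h' => h'.trans h⟩
    have : Std.Irrefl (fun a b => Relation.TransGen D.Adj b a) := ⟨fun a h => hD a h⟩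
    exact Finite.wellFounded_of_trans_of_irrefl _
  -- Minimality in the reversed order makes `x` a sink of `s`, hence of `D`, as arcs do not leave
  -- `s`.
  obtain ⟨x, hxs, hx⟩ := hwf.has_min s hs
  have hsink : ∀ v, ¬ D.Adj x v := fun v h =>
    hx v (hadj x hxs v (moralGraph_adj.2 ⟨hD.ne h, Or.inl h⟩)) (.single h)
  have hpar : ∀ v, D.moralGraph.Adj x v → D.Adj v x := by
    intro v hv
    rcases (moralGraph_adj.1 hv).2 with h | h | ⟨w, h, -⟩
    · exact absurd h (hsink v)
    · exact h
    · exact absurd h (hsink w)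
  exact ⟨x, hxs, fun u hu v hv huv =>
    moralGraph_adj.2 ⟨huv, Or.inr (Or.inr ⟨x, hpar u hu, hpar v hv⟩)⟩⟩

/-! ### Runs of the elimination procedure -/

/-- Isolated vertices do not affect morality: no arc meets them. So all graphs of a run can be
compared on the fixed vertex set `V`. -/
theorem Subgraph.isMoral_coe_iff {G : SimpleGraph V} (H : G.Subgraph) :
    H.coe.IsMoral ↔ H.spanningCoe.IsMoral := by
  constructor
  · rintro ⟨D, hD, hDH⟩
    refine ⟨⟨fun u v => ∃ (hu : u ∈ H.verts) (hv : v ∈ H.verts), D.Adj ⟨u, hu⟩ ⟨v, hv⟩⟩, ?_, ?_⟩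
    · intro v hv
      have key : ∀ a b, Relation.TransGen (fun u v => ∃ (hu : u ∈ H.verts) (hv : v ∈ H.verts),
          D.Adj ⟨u, hu⟩ ⟨v, hv⟩) a b → ∃ (ha : a ∈ H.verts) (hb : b ∈ H.verts),
          Relation.TransGen D.Adj ⟨a, ha⟩ ⟨b, hb⟩ := by
        intro a b hab
        induction hab with
        | single h => exact ⟨h.1, h.2.1, .single h.2.2⟩
        | tail _ h ih => exact ⟨ih.1, h.2.1, ih.2.2.tail h.2.2⟩
      obtain ⟨hv, _, h⟩ := key v v hv
      exact hD _ h
    · ext u v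
      have key : ∀ (hu : u ∈ H.verts) (hv : v ∈ H.verts),
          D.moralGraph.Adj ⟨u, hu⟩ ⟨v, hv⟩ ↔ H.Adj u v := by
        intro hu hv
        rw [hDH]
        rfl
      simp only [moralGraph_adj, Subgraph.spanningCoe_adj] at key ⊢
      constructor
      · rintro ⟨huv, ⟨hu, hv, h⟩ | ⟨hv, hu, h⟩ | ⟨w, ⟨hu, hw, h⟩, ⟨hv, hw', h'⟩⟩⟩
        · exact (key hu hv).1 ⟨by simpa using huv, Or.inl h⟩
        · exact (key hu hv).1 ⟨by simpa using huv, Or.inr (Or.inl h)⟩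
        · exact (key hu hv).1 ⟨by simpa using huv, Or.inr (Or.inr ⟨_, h, h'⟩)⟩
      · intro h
        have hu := H.edge_vert h
        have hv := H.edge_vert h.symm
        obtain ⟨huv, h⟩ := (key hu hv).2 h
        refine ⟨by simpa using huv, ?_⟩
        rcases h with h | h | ⟨⟨w, hw⟩, h, h'⟩
        · exact Or.inl ⟨hu, hv, h⟩
        · exact Or.inr (Or.inl ⟨hv, hu, h⟩)
        · exact Or.inr (Or.inr ⟨w, ⟨hu, hw, h⟩, hv, hw, h'⟩)
  · rintro ⟨D, hD, hDH⟩
    have key : ∀ u v, D.moralGraph.Adj u v ↔ H.Adj u v := by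
      intro u v
      rw [hDH]
      rfl
    refine ⟨⟨fun u v => D.Adj u v⟩, fun v hv => ?_, ?_⟩
    · exact hD v (Relation.TransGen.lift (p := D.Adj) Subtype.val (fun _ _ h => h) v v hv)
    · ext ⟨u, hu⟩ ⟨v, hv⟩
      rw [moralGraph_adj, Subgraph.coe_adj, ← key, moralGraph_adj]
      refine and_congr (by simp) (or_congr_right (or_congr_right ?_))
      constructor
      · rintro ⟨⟨w, _⟩, h⟩
        exact ⟨w, h⟩
      · rintro ⟨w, h⟩
        exact ⟨⟨w, H.edge_vert ((key w u).1
          (moralGraph_adj.2 ⟨(hD.ne h.1).symm, Or.inr (Or.inl h.1)⟩))⟩, h⟩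

theorem Subgraph.spanningCoe_eliminate {G : SimpleGraph V} (H : G.Subgraph) (x : V) :
    (H.eliminate x).spanningCoe = H.spanningCoe.isolate x := by
  ext u v
  simp only [Subgraph.eliminate, isolate, Subgraph.spanningCoe_adj, Subgraph.deleteEdges_adj,
    Subgraph.mem_edgeSet, Subgraph.induce_adj, Subgraph.mem_neighborSet]
  constructor
  · rintro ⟨⟨⟨-, hu⟩, ⟨-, hv⟩, h⟩, h'⟩
    refine ⟨h, ?_⟩
    rintro ⟨hu' | hu', hv' | hv'⟩
    · exact hu hu'
    · exact hu hu'
    · exact hv hv'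
    · exact h' ⟨hu', hv', h⟩
  · rintro ⟨h, h'⟩
    have hu : u ≠ x := by
      rintro rfl
      exact h' ⟨Or.inl rfl, Or.inr h⟩
    have hv : v ≠ x := by
      rintro rfl
      exact h' ⟨Or.inr h.symm, Or.inl rfl⟩
    exact ⟨⟨⟨H.edge_vert h, hu⟩, ⟨H.edge_vert h.symm, hv⟩, h⟩, by tauto⟩

theorem Subgraph.IsSimplicial.isClique {G : SimpleGraph V} {H : G.Subgraph} {x : V}
    (h : H.IsSimplicial x) : H.spanningCoe.IsClique (H.spanningCoe.neighborSet x) :=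
  fun _ hu _ hv huv => h.2 hu hv huv

theorem ElimRun.ncard_verts_add [Finite V] {G : SimpleGraph V} {k : ℕ} {H : G.Subgraph}
    (h : G.ElimRun k H) : H.verts.ncard + k = Nat.card V := by
  induction h with
  | start => simp [Set.ncard_univ]
  | @step k H x _ hx ih =>
    have : (H.eliminate x).verts = H.verts \ {x} := rfl
    rw [this, ← ih, ← Set.ncard_sdiff_singleton_add_one hx.1]
    omega

/-- The invariant of the procedure; subcubicity passes to every graph of a run because only edges
are lost. -/
theorem ElimRun.isMoral_iff {G : SimpleGraph V} (hG : G.IsSubcubic) {k : ℕ} {H : G.Subgraph}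
    (h : G.ElimRun k H) : H.spanningCoe.IsMoral ↔ G.IsMoral := by
  induction h with
  | start => simp
  | @step k H x _ hx ih =>
    rw [Subgraph.spanningCoe_eliminate, ← ih]
    exact ⟨.of_isolate hx.isClique, .isolate (hG.mono H.spanningCoe_le) hx.isClique⟩

theorem ElimRun.eq_bot_iff [Finite V] {G : SimpleGraph V} (hG : G.IsSubcubic) {k : ℕ}
    {H : G.Subgraph} (h : G.ElimRun k H) (hterm : ∀ x, ¬ H.IsSimplicial x) :
    H = ⊥ ↔ G.IsMoral := by
  rw [← h.isMoral_iff hG]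
  constructor
  · rintro rfl
    simpa using isMoral_bot
  · intro hH
    have hverts : H.verts = ∅ := by
      by_contra hne
      -- The remaining vertices are closed under adjacency, which excludes the isolated leftovers of
      -- earlier eliminations.
      obtain ⟨x, hx, hxc⟩ := hH.exists_isClique_neighborSet
        (Set.nonempty_iff_ne_empty.2 hne) fun u _ v huv => H.edge_vert (H.adj_symm huv)
      exact hterm x ⟨hx, fun u hu v hv huv => hxc hu hv huv⟩
    ext u v
    · simp [hverts]
    · simp only [Subgraph.not_bot_adj, iff_false]
      intro huv
      simpa [hverts] using H.edge_vert huv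

end SimpleGraph

/-! ### Structured programs for stack machines -/

namespace StackProg

open Turing

/-- Elementary operations on the register and the stacks. -/
inductive Op {K : Type} (Γ : K → Type) (σ : Type)
  | push (k : K) (f : σ → Γ k)
  | pop (k : K) (f : σ → Option (Γ k) → σ)
  | load (f : σ → σ)

/-- Structured programs: blocks of elementary operations, sequential composition, conditionals
and loops. -/
inductive Prog {K : Type} (Γ : K → Type) (σ : Type)
  | ops (l : List (Op Γ σ))
  | seq (p q : Prog Γ σ)
  | ite (c : σ → Bool) (p q : Prog Γ σ)
  | loop (c : σ → Bool) (p : Prog Γ σ)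

variable {K : Type} {Γ : K → Type} {σ : Type}

/-- The control points of a program. -/
def Prog.Lab : Prog Γ σ → Type
  | .ops _ => Unit
  | .seq p q => p.Lab ⊕ q.Lab
  | .ite _ p q => Option (p.Lab ⊕ q.Lab)
  | .loop _ p => Option p.Lab

noncomputable instance Prog.fintypeLab : (p : Prog Γ σ) → Fintype p.Lab
  | .ops _ => inferInstanceAs (Fintype Unit)
  | .seq p q => @instFintypeSum _ _ p.fintypeLab q.fintypeLab
  | .ite _ p q => @instFintypeOption _ (@instFintypeSum _ _ p.fintypeLab q.fintypeLab)
  | .loop _ p => @instFintypeOption _ p.fintypeLab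

/-- The control point at which a program starts. -/
def Prog.entry : (p : Prog Γ σ) → p.Lab
  | .ops _ => ()
  | .seq p _ => Sum.inl p.entry
  | .ite _ _ _ => none
  | .loop _ _ => none

/-- The stack machine statement that performs an operation and continues with `q`. -/
def Op.toStmt {Λ : Type} : Op Γ σ → TM2.Stmt Γ Λ σ → TM2.Stmt Γ Λ σ
  | .push k f, q => .push k f q
  | .pop k f, q => .pop k f q
  | .load f, q => .load f q

/-- The code of a program inside a machine with labels `Λ`, where the control points are placed by
`emb` and the program is left to the label `cont`. -/
def Prog.code {Λ : Type} : (p : Prog Γ σ) → (p.Lab → Λ) → Λ → p.Lab → TM2.Stmt Γ Λ σ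
  | .ops l, _, cont, _ => l.foldr Op.toStmt (.goto fun _ => cont)
  | .seq p q, emb, _, Sum.inl a => p.code (emb ∘ Sum.inl) (emb (Sum.inr q.entry)) a
  | .seq _ q, emb, cont, Sum.inr b => q.code (emb ∘ Sum.inr) cont b
  | .ite c p q, emb, _, none =>
      .branch c (.goto fun _ => emb (some (Sum.inl p.entry)))
        (.goto fun _ => emb (some (Sum.inr q.entry)))
  | .ite _ p _, emb, cont, some (Sum.inl a) => p.code (emb ∘ some ∘ Sum.inl) cont a
  | .ite _ _ q, emb, cont, some (Sum.inr b) => q.code (emb ∘ some ∘ Sum.inr) cont b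
  | .loop c p, emb, cont, none =>
      .branch c (.goto fun _ => emb (some p.entry)) (.goto fun _ => cont)
  | .loop _ p, emb, _, some a => p.code (emb ∘ some) (emb none) a

variable [DecidableEq K]

/-- The effect of an elementary operation. -/
def Op.run : Op Γ σ → σ × (∀ k, List (Γ k)) → σ × (∀ k, List (Γ k))
  | .push k f, s => (s.1, Function.update s.2 k (f s.1 :: s.2 k))
  | .pop k f, s => (f s.1 (s.2 k).head?, Function.update s.2 k (s.2 k).tail)
  | .load f, s => (f s.1, s.2)

/-- The effect of a block of elementary operations. -/
def runOps (l : List (Op Γ σ)) (s : σ × (∀ k, List (Γ k))) : σ × (∀ k, List (Γ k)) :=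
  l.foldl (fun s o => o.run s) s

/-- The machine `M` gets from configuration `c` to configuration `c'` in at most `T` steps. -/
def Reach {Λ : Type} (M : Λ → TM2.Stmt Γ Λ σ) (c c' : TM2.Cfg Γ Λ σ) (T : ℕ) : Prop :=
  ∃ t ≤ T, (flip bind (TM2.step M))^[t] (some c) = some c'

theorem Reach.single {Λ : Type} {M : Λ → TM2.Stmt Γ Λ σ} {c c' : TM2.Cfg Γ Λ σ}
    (h : TM2.step M c = some c') : Reach M c c' 1 :=
  ⟨1, le_rfl, h⟩

theorem Reach.trans {Λ : Type} {M : Λ → TM2.Stmt Γ Λ σ} {c c' c'' : TM2.Cfg Γ Λ σ} {T T' : ℕ}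
    (h : Reach M c c' T) (h' : Reach M c' c'' T') : Reach M c c'' (T + T') := by
  obtain ⟨t, ht, h⟩ := h
  obtain ⟨t', ht', h'⟩ := h'
  exact ⟨t' + t, by omega, by rw [Function.iterate_add_apply, h, h']⟩

/-- Started in state `s`, the program `p` ends in state `s'` after at most `T` steps. -/
def Takes (p : Prog Γ σ) (s s' : σ × (∀ k, List (Γ k))) (T : ℕ) : Prop :=
  ∀ (Λ : Type) (M : Λ → TM2.Stmt Γ Λ σ) (emb : p.Lab → Λ) (cont : Λ),
    (∀ a, M (emb a) = p.code emb cont a) →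
      Reach M ⟨some (emb p.entry), s.1, s.2⟩ ⟨some cont, s'.1, s'.2⟩ T

theorem Takes.mono {p : Prog Γ σ} {s s' : σ × (∀ k, List (Γ k))} {T T' : ℕ}
    (h : Takes p s s' T) (hT : T ≤ T') : Takes p s s' T' := fun Λ M emb cont hM =>
  let ⟨t, ht, h⟩ := h Λ M emb cont hM
  ⟨t, ht.trans hT, h⟩

/-- A statement runs up to its next jump within one machine step, so a block of any length costs a
single step. -/
theorem stepAux_foldr_toStmt {Λ : Type} (l : List (Op Γ σ)) (q : TM2.Stmt Γ Λ σ)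
    (s : σ × (∀ k, List (Γ k))) :
    TM2.stepAux (l.foldr Op.toStmt q) s.1 s.2 =
      TM2.stepAux q (runOps l s).1 (runOps l s).2 := by
  induction l generalizing s with
  | nil => rfl
  | cons o l ih =>
    cases o with
    | push k f => exact ih (s.1, Function.update s.2 k (f s.1 :: s.2 k))
    | pop k f => exact ih (f s.1 (s.2 k).head?, Function.update s.2 k (s.2 k).tail)
    | load f => exact ih (f s.1, s.2)

theorem Takes.ops (l : List (Op Γ σ)) (s : σ × (∀ k, List (Γ k))) :
    Takes (.ops l) s (runOps l s) 1 := fun Λ M emb cont hM => by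
  refine Reach.single ?_
  simp only [TM2.step, hM, Prog.code, stepAux_foldr_toStmt]
  rfl

/-- Composition works because `Takes` ranges over all machines, label placements and exits: the exit
of `p` is instantiated with the entry of `q`. -/
theorem Takes.seq {p q : Prog Γ σ} {s s' s'' : σ × (∀ k, List (Γ k))} {T T' : ℕ}
    (h : Takes p s s' T) (h' : Takes q s' s'' T') : Takes (.seq p q) s s'' (T + T') :=
  fun Λ M emb cont hM =>
    (h Λ M (emb ∘ Sum.inl) (emb (Sum.inr q.entry)) fun a => hM (Sum.inl a)).trans
      (h' Λ M (emb ∘ Sum.inr) cont fun a => hM (Sum.inr a))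

theorem Takes.ite_true {c : σ → Bool} {p q : Prog Γ σ} {s s' : σ × (∀ k, List (Γ k))} {T : ℕ}
    (hc : c s.1 = true) (h : Takes p s s' T) : Takes (.ite c p q) s s' (1 + T) :=
  fun Λ M emb cont hM =>
    (Reach.single (by
      have := hM none
      simp [TM2.step, Prog.entry, this, Prog.code, hc]
      rfl)).trans
      (h Λ M (emb ∘ some ∘ Sum.inl) cont fun a => hM (some (Sum.inl a)))

theorem Takes.ite_false {c : σ → Bool} {p q : Prog Γ σ} {s s' : σ × (∀ k, List (Γ k))} {T : ℕ}
    (hc : c s.1 = false) (h : Takes q s s' T) : Takes (.ite c p q) s s' (1 + T) :=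
  fun Λ M emb cont hM =>
    (Reach.single (by
      have := hM none
      simp [TM2.step, Prog.entry, this, Prog.code, hc]
      rfl)).trans
      (h Λ M (emb ∘ some ∘ Sum.inr) cont fun a => hM (some (Sum.inr a)))

theorem Takes.loop_false {c : σ → Bool} {p : Prog Γ σ} {s : σ × (∀ k, List (Γ k))}
    (hc : c s.1 = false) : Takes (.loop c p) s s 1 := fun Λ M emb cont hM =>
  Reach.single (by
    have := hM none
    simp [TM2.step, Prog.entry, this, Prog.code, hc])

theorem Takes.loop_true {c : σ → Bool} {p : Prog Γ σ} {s s' s'' : σ × (∀ k, List (Γ k))}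
    {T T' : ℕ} (hc : c s.1 = true) (h : Takes p s s' T) (h' : Takes (.loop c p) s' s'' T') :
    Takes (.loop c p) s s'' (1 + T + T') := fun Λ M emb cont hM =>
  ((Reach.single (by
      have := hM none
      simp [TM2.step, Prog.entry, this, Prog.code, hc]
      rfl)).trans
    (h Λ M (emb ∘ some) (emb none) fun a => hM (some a))).trans (h' Λ M emb cont hM)

/-- The stack machine of a program. -/
noncomputable def Prog.toTM [Fintype K] [Fintype σ] (p : Prog Γ σ) (k₀ k₁ : K)
    [Fintype (Γ k₀)] (v₀ : σ) : FinTM2 where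
  K := K
  k₀ := k₀
  k₁ := k₁
  Γ := Γ
  Λ := Option p.Lab
  main := some p.entry
  σ := σ
  initialState := v₀
  m
    | none => .halt
    | some a => p.code some none a

theorem initList_eq (tm : FinTM2) (l : List (tm.Γ tm.k₀)) :
    initList tm l = ⟨some tm.main, tm.initialState, Function.update (fun _ => []) tm.k₀ l⟩ := by
  refine (TM2.Cfg.mk.injEq ..).mpr ⟨rfl, rfl, funext fun k => ?_⟩
  by_cases h : k = tm.k₀
  · subst h
    simp
  · simp [h]

theorem haltList_eq (tm : FinTM2) (l : List (tm.Γ tm.k₁)) :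
    haltList tm l = ⟨none, tm.initialState, Function.update (fun _ => []) tm.k₁ l⟩ := by
  refine (TM2.Cfg.mk.injEq ..).mpr ⟨rfl, rfl, funext fun k => ?_⟩
  by_cases h : k = tm.k₁
  · subst h
    simp
  · simp [h]

/-- A program that turns the encoding of `a` on the input stack into the encoding of `f a` on the
output stack within polynomial time gives rise to a polynomial-time machine. -/
theorem Prog.nonempty_tm2ComputableInPolyTime [Fintype K] [Fintype σ] (p : Prog Γ σ) (k₀ k₁ : K)
    [Fintype (Γ k₀)] (v₀ : σ) {α β : Type} (ea : α → List (Γ k₀)) (eb : β → List (Γ k₁))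
    (f : α → β) (time : Polynomial ℕ)
    (h : ∀ a, Takes p (v₀, Function.update (fun _ => []) k₀ (ea a))
      (v₀, Function.update (fun _ => []) k₁ (eb (f a))) (time.eval (ea a).length)) :
    Nonempty (TM2ComputableInPolyTime ea eb f) := by
  -- The lists are generalised because the machine model passes them through alphabet equivalences,
  -- here identities up to `List.map_id`. The extra step is the final halt.
  have key : ∀ a l l', l = ea a → l' = eb (f a) → Nonempty (TM2OutputsInTime
      (p.toTM k₀ k₁ v₀) l (some l') ((time + 1).eval (ea a).length)) := by
    rintro a l l' rfl rfl
    obtain ⟨t, ht, ht'⟩ :=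
      (h a (Option p.Lab) (p.toTM k₀ k₁ v₀).m some none fun _ => rfl).trans
        (Reach.single (c' := ⟨none, v₀, Function.update (fun _ => []) k₁ (eb (f a))⟩) rfl)
    refine ⟨⟨⟨t, ?_⟩, by simpa using ht⟩⟩
    refine Eq.trans ?_ (ht'.trans ?_)
    · exact congrArg (fun c => (flip bind (p.toTM k₀ k₁ v₀).step)^[t] (some c))
        (initList_eq (p.toTM k₀ k₁ v₀) (ea a))
    · exact congrArg some (haltList_eq (p.toTM k₀ k₁ v₀) (eb (f a))).symm
  exact ⟨⟨⟨p.toTM k₀ k₁ v₀, Equiv.refl _, Equiv.refl _⟩, time + 1,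
    fun a => (key a _ _ (List.map_id _) (List.map_id _)).some⟩⟩

end StackProg

/-! ### Reasoning about loops -/

namespace StackProg

variable {K : Type} {Γ : K → Type} {σ : Type} [DecidableEq K]

theorem Takes.ops_of_eq {l : List (Op Γ σ)} {s s' : σ × (∀ k, List (Γ k))}
    (h : runOps l s = s') : Takes (.ops l) s s' 1 :=
  h ▸ Takes.ops l s

/-- Passes through the loop `loop c p` lead from the state `s` to the state `s'` within `T`
steps. -/
def Iter (c : σ → Bool) (p : Prog Γ σ) (s s' : σ × (∀ k, List (Γ k))) (T : ℕ) : Prop :=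
  ∀ s'' T', Takes (.loop c p) s' s'' T' → Takes (.loop c p) s s'' (T + T')

theorem Iter.mono {c : σ → Bool} {p : Prog Γ σ} {s s' : σ × (∀ k, List (Γ k))} {T T' : ℕ}
    (h : Iter c p s s' T) (hT : T ≤ T') : Iter c p s s' T' := fun s'' T'' h' =>
  (h s'' T'' h').mono (by omega)

theorem Iter.refl (c : σ → Bool) (p : Prog Γ σ) (s : σ × (∀ k, List (Γ k))) :
    Iter c p s s 0 := fun _ _ h => h.mono (by omega)

/-- Since `Iter` is stated relative to any completion of the loop, stretches of passes can be
concatenated; in `Iter.list` one item may thus take many passes. -/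
theorem Iter.trans {c : σ → Bool} {p : Prog Γ σ} {s s' s'' : σ × (∀ k, List (Γ k))} {T T' : ℕ}
    (h : Iter c p s s' T) (h' : Iter c p s' s'' T') : Iter c p s s'' (T + T') :=
  fun t U ht => (h t (T' + U) (h' t U ht)).mono (by omega)

theorem Iter.single {c : σ → Bool} {p : Prog Γ σ} {s s' : σ × (∀ k, List (Γ k))} {T : ℕ}
    (hc : c s.1 = true) (h : Takes p s s' T) : Iter c p s s' (1 + T) :=
  fun _ _ ht => Takes.loop_true hc h ht

theorem Iter.takes {c : σ → Bool} {p : Prog Γ σ} {s s' : σ × (∀ k, List (Γ k))} {T : ℕ}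
    (h : Iter c p s s' T) (hc : c s'.1 = false) : Takes (.loop c p) s s' (T + 1) :=
  h _ _ (Takes.loop_false hc)

/-- Induction over a list processed by a loop: `st done rem` is the state in which `done` has been
processed and `rem` remains. -/
theorem Iter.list {α : Type} {c : σ → Bool} {p : Prog Γ σ}
    (st : List α → List α → σ × (∀ k, List (Γ k))) (l : List α) (B : ℕ)
    (h : ∀ done a rem, l = done ++ a :: rem →
      Iter c p (st done (a :: rem)) (st (done ++ [a]) rem) B) :
    Iter c p (st [] l) (st l []) (l.length * B) := by
  have key : ∀ rem done, l = done ++ rem →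
      Iter c p (st done rem) (st l []) (rem.length * B) := by
    intro rem
    induction rem with
    | nil =>
      rintro done rfl
      simpa using Iter.refl c p _
    | cons a rem ih =>
      intro done hl
      refine ((h done a rem hl).trans (ih (done ++ [a]) (by simpa using hl))).mono ?_
      rw [List.length_cons]
      linarith
  exact key l [] rfl

end StackProg

/-! ### The elimination machine -/

namespace MoralMachine

open StackProg

/-- Symbols of the working stacks: matrix entries, where `diag` is a diagonal entry and `mark` a
one that may have to be cleared, and the end-of-row mark. -/
inductive Sym
  | zero | one | diag | mark | eor
  deriving DecidableEq

instance : Fintype Sym :=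
  ⟨{.zero, .one, .diag, .mark, .eor}, fun x => by cases x <;> simp⟩

/-- The stacks: input, output, current matrix, scratch matrix, column mask with its scratch copy,
row mask, snapshot of the matrix, round counter. -/
inductive Stk
  | inp | out | mat | aux | mask | mask' | rowMask | snap | cnt
  deriving DecidableEq

instance : Fintype Stk :=
  ⟨{.inp, .out, .mat, .aux, .mask, .mask', .rowMask, .snap, .cnt}, fun x => by cases x <;> simp⟩

/-- The stack alphabets. -/
abbrev Alph : Stk → Type
  | .inp => Option Bool
  | .out => Bool
  | .mat | .aux | .mask | .mask' | .rowMask | .snap | .cnt => Sym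

/-- The register: the symbol under inspection, the column and row masks that belong to it, and a
flag. -/
structure Reg where
  cur : Option Sym
  msk : Option Sym
  row : Option Sym
  ok : Bool

noncomputable instance : Fintype Reg :=
  Fintype.ofInjective (fun v : Reg => (v.cur, v.msk, v.row, v.ok)) fun v w h => by
    cases v
    cases w
    simpa using h

/-- The contents of all stacks. -/
def contents (i : List (Option Bool)) (o : List Bool) (m a k k' r s c : List Sym) :
    ∀ k, List (Alph k)
  | .inp => i
  | .out => o
  | .mat => m
  | .aux => a
  | .mask => k
  | .mask' => k'
  | .rowMask => r
  | .snap => s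
  | .cnt => c

section contents

variable (i : List (Option Bool)) (o : List Bool) (m a k k' r s c : List Sym)

@[simp] theorem update_inp (x : List (Option Bool)) :
    Function.update (contents i o m a k k' r s c) .inp x = contents x o m a k k' r s c := by
  funext j
  cases j <;> rfl

@[simp] theorem update_out (x : List Bool) :
    Function.update (contents i o m a k k' r s c) .out x = contents i x m a k k' r s c := by
  funext j
  cases j <;> rfl

variable (x : List Sym)

@[simp] theorem update_mat :
    Function.update (contents i o m a k k' r s c) .mat x = contents i o x a k k' r s c := by
  funext j
  cases j <;> rfl

@[simp] theorem update_aux :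
    Function.update (contents i o m a k k' r s c) .aux x = contents i o m x k k' r s c := by
  funext j
  cases j <;> rfl

@[simp] theorem update_mask :
    Function.update (contents i o m a k k' r s c) .mask x = contents i o m a x k' r s c := by
  funext j
  cases j <;> rfl

@[simp] theorem update_mask' :
    Function.update (contents i o m a k k' r s c) .mask' x = contents i o m a k x r s c := by
  funext j
  cases j <;> rfl

@[simp] theorem update_rowMask :
    Function.update (contents i o m a k k' r s c) .rowMask x = contents i o m a k k' x s c := by
  funext j
  cases j <;> rfl

@[simp] theorem update_snap :
    Function.update (contents i o m a k k' r s c) .snap x = contents i o m a k k' r x c := by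
  funext j
  cases j <;> rfl

@[simp] theorem update_cnt :
    Function.update (contents i o m a k k' r s c) .cnt x = contents i o m a k k' r s x := by
  funext j
  cases j <;> rfl

@[simp] theorem contents_inp : contents i o m a k k' r s c .inp = i := rfl
@[simp] theorem contents_out : contents i o m a k k' r s c .out = o := rfl
@[simp] theorem contents_mat : contents i o m a k k' r s c .mat = m := rfl
@[simp] theorem contents_aux : contents i o m a k k' r s c .aux = a := rfl
@[simp] theorem contents_mask : contents i o m a k k' r s c .mask = k := rfl
@[simp] theorem contents_mask' : contents i o m a k k' r s c .mask' = k' := rfl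
@[simp] theorem contents_rowMask : contents i o m a k k' r s c .rowMask = r := rfl
@[simp] theorem contents_snap : contents i o m a k k' r s c .snap = s := rfl
@[simp] theorem contents_cnt : contents i o m a k k' r s c .cnt = c := rfl

end contents

abbrev P := Prog Alph Reg

/-- A symbol is under inspection. -/
def busy (v : Reg) : Bool := v.cur.isSome

/-- The end of a row has been reached. -/
def atEnd (v : Reg) : Bool := v.cur == some .eor

/-- Repeat `p` as long as the operation `o` delivers a symbol. -/
def each (o : Op Alph Reg) (p : P) : P :=
  .seq (.ops [o]) (.loop busy (.seq p (.ops [o])))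

/-- In `st done (a :: rem)` the item `a` has typically been fetched already, hence the heads and
tails in the applications. The 2 pays for the first fetch and the last loop test. -/
theorem takes_each {α : Type} {o : Op Alph Reg} {p : P} {s₀ : Reg × (∀ k, List (Alph k))}
    (st : List α → List α → Reg × (∀ k, List (Alph k))) (l : List α) (B : ℕ)
    (h₀ : runOps [o] s₀ = st [] l) (hend : (st l []).1.cur = none)
    (h : ∀ done a rem, l = done ++ a :: rem →
      Iter busy (.seq p (.ops [o])) (st done (a :: rem)) (st (done ++ [a]) rem) B) :
    Takes (each o p) s₀ (st l []) (l.length * B + 2) :=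
  ((Takes.ops_of_eq h₀).seq ((Iter.list st l B h).takes (by simp [busy, hend]))).mono (by omega)

def popMat : Op Alph Reg := .pop .mat fun v x => { v with cur := x }
def popAux : Op Alph Reg := .pop .aux fun v x => { v with cur := x }
def popMask : Op Alph Reg := .pop .mask fun v x => { v with cur := x }
def popMask' : Op Alph Reg := .pop .mask' fun v x => { v with cur := x }
def popSnap : Op Alph Reg := .pop .snap fun v x => { v with cur := x }
def popCnt : Op Alph Reg := .pop .cnt fun v x => { v with cur := x }

/-- The symbol that represents an input symbol. -/
def conv : Option Bool → Sym
  | none => .eor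
  | some true => .one
  | some false => .zero

def popInp : Op Alph Reg := .pop .inp fun v x => { v with cur := x.map conv }

/-- The symbol under inspection. -/
def Reg.sym (v : Reg) : Sym := v.cur.getD .zero

/-- Read the input: copy it, reversed, to `aux` and to the round counter. -/
def readInput : P := each popInp (.ops [.push .aux Reg.sym, .push .cnt Reg.sym])

/-- Three steps per symbol: loop test, body, next fetch. Moving a stack reverses it, so later
transfers come in pairs. -/
theorem takes_readInput (l : List (Option Bool)) :
    Takes readInput (⟨none, none, none, true⟩, contents l [] [] [] [] [] [] [] [])
      (⟨none, none, none, true⟩,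
        contents [] [] [] (l.map conv).reverse [] [] [] [] (l.map conv).reverse)
      (l.length * 3 + 2) := by
  refine takes_each (fun done rem => (⟨rem.head?.map conv, none, none, true⟩,
    contents rem.tail [] [] (done.map conv).reverse [] [] [] [] (done.map conv).reverse))
    l 3 ?_ rfl ?_
  · simp [runOps, Op.run, popInp]
  · intro done a rem _
    refine Iter.single rfl ((Takes.ops_of_eq rfl).seq (Takes.ops_of_eq ?_))
    simp [runOps, Op.run, popInp, Reg.sym]

/-- Copy the matrix, reversed, to `aux`. -/
def reverseMat : P := each popMat (.ops [.push .aux Reg.sym])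

theorem takes_reverseMat (x : Option Sym) (l c : List Sym) :
    Takes reverseMat (⟨x, none, none, true⟩, contents [] [] l [] [] [] [] [] c)
      (⟨none, none, none, true⟩, contents [] [] [] l.reverse [] [] [] [] c)
      (l.length * 3 + 2) := by
  refine takes_each (fun done rem => (⟨rem.head?, none, none, true⟩,
    contents [] [] rem.tail done.reverse [] [] [] [] c)) l 3 ?_ rfl ?_
  · simp [runOps, Op.run, popMat]
  · intro done a rem _
    refine Iter.single rfl ((Takes.ops_of_eq rfl).seq (Takes.ops_of_eq ?_))
    simp [runOps, Op.run, popMat, Reg.sym]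

/-- Restore the matrix from its reversed copy and take a snapshot of it. -/
def snapshot : P := each popAux (.ops [.push .mat Reg.sym, .push .snap Reg.sym])

theorem takes_snapshot (l c : List Sym) :
    Takes snapshot (⟨none, none, none, true⟩, contents [] [] [] l.reverse [] [] [] [] c)
      (⟨none, none, none, true⟩, contents [] [] l [] [] [] [] l c)
      (l.length * 3 + 2) := by
  have := takes_each (o := popAux) (p := .ops [.push .mat Reg.sym, .push .snap Reg.sym])
    (s₀ := (⟨none, none, none, true⟩, contents [] [] [] l.reverse [] [] [] [] c))
    (fun done rem => (⟨rem.head?, none, none, true⟩,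
      contents [] [] done.reverse rem.tail [] [] [] done.reverse c)) l.reverse 3 ?_ rfl ?_
  · simpa [snapshot] using this
  · simp [runOps, Op.run, popAux]
  · intro done a rem _
    refine Iter.single rfl ((Takes.ops_of_eq rfl).seq (Takes.ops_of_eq ?_))
    simp [runOps, Op.run, popAux, Reg.sym]

/-- What a marked symbol becomes. -/
def resolve (b : Bool) : Sym → Sym
  | .mark => if b then .zero else .one
  | e => e

/-- Restore the matrix from its reversed copy; the flag decides what becomes of the marked
symbols. -/
def restoreMat : P := each popAux (.ops [.push .mat fun v => resolve v.ok v.sym])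

/-- Whether a mask is a clique is known only after the whole matrix has been scanned; the return
transfer settles the marked entries. -/
theorem takes_restoreMat (b : Bool) (l s c : List Sym) :
    Takes restoreMat (⟨none, none, none, b⟩, contents [] [] [] l.reverse [] [] [] s c)
      (⟨none, none, none, b⟩, contents [] [] (l.map (resolve b)) [] [] [] [] s c)
      (l.length * 3 + 2) := by
  have := takes_each (o := popAux) (p := .ops [.push .mat fun v => resolve v.ok v.sym])
    (s₀ := (⟨none, none, none, b⟩, contents [] [] [] l.reverse [] [] [] s c))
    (fun done rem => (⟨rem.head?, none, none, b⟩,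
      contents [] [] (done.map (resolve b)).reverse rem.tail [] [] [] s c)) l.reverse 3 ?_ rfl ?_
  · simpa [restoreMat] using this
  · simp [runOps, Op.run, popAux]
  · intro done a rem _
    refine Iter.single rfl ((Takes.ops_of_eq rfl).seq (Takes.ops_of_eq ?_))
    simp [runOps, Op.run, popAux, Reg.sym]

/-- Restore the mask from its scratch copy. -/
def restoreMask : P := each popMask' (.ops [.push .mask Reg.sym])

theorem takes_restoreMask (x row : Option Sym) (b : Bool) (m a k l r s c : List Sym) :
    Takes restoreMask (⟨x, none, row, b⟩, contents [] [] m a k l.reverse r s c)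
      (⟨none, none, row, b⟩, contents [] [] m a (l ++ k) [] r s c)
      (l.length * 3 + 2) := by
  have := takes_each (o := popMask') (p := .ops [.push .mask Reg.sym])
    (s₀ := (⟨x, none, row, b⟩, contents [] [] m a k l.reverse r s c))
    (fun done rem => (⟨rem.head?, none, row, b⟩,
      contents [] [] m a (done.reverse ++ k) rem.tail r s c)) l.reverse 3 ?_ rfl ?_
  · simpa [restoreMask] using this
  · simp [runOps, Op.run, popMask']
  · intro done a rem _
    refine Iter.single rfl ((Takes.ops_of_eq rfl).seq (Takes.ops_of_eq ?_))
    simp [runOps, Op.run, popMask', Reg.sym]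

/-- Load both masks from the scratch copy. -/
def loadMasks : P := each popMask' (.ops [.push .mask Reg.sym, .push .rowMask Reg.sym])

theorem takes_loadMasks (x : Option Sym) (m l s c : List Sym) :
    Takes loadMasks (⟨x, none, none, true⟩, contents [] [] m [] [] l.reverse [] s c)
      (⟨none, none, none, true⟩, contents [] [] m [] l [] l s c)
      (l.length * 3 + 2) := by
  have := takes_each (o := popMask') (p := .ops [.push .mask Reg.sym, .push .rowMask Reg.sym])
    (s₀ := (⟨x, none, none, true⟩, contents [] [] m [] [] l.reverse [] s c))
    (fun done rem => (⟨rem.head?, none, none, true⟩,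
      contents [] [] m [] done.reverse rem.tail done.reverse s c)) l.reverse 3 ?_ rfl ?_
  · simpa [loadMasks] using this
  · simp [runOps, Op.run, popMask']
  · intro done a rem _
    refine Iter.single rfl ((Takes.ops_of_eq rfl).seq (Takes.ops_of_eq ?_))
    simp [runOps, Op.run, popMask', Reg.sym]

/-- Empty the mask. -/
def clearMask : P := each popMask (.ops [])

theorem takes_clearMask (b : Bool) (m a l s c : List Sym) :
    Takes clearMask (⟨none, none, none, b⟩, contents [] [] m a l [] [] s c)
      (⟨none, none, none, b⟩, contents [] [] m a [] [] [] s c)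
      (l.length * 3 + 2) := by
  refine takes_each (fun done rem => (⟨rem.head?, none, none, b⟩,
    contents [] [] m a rem.tail [] [] s c)) l 3 ?_ rfl ?_
  · simp [runOps, Op.run, popMask]
  · intro done a rem _
    refine Iter.single rfl ((Takes.ops_of_eq rfl).seq (Takes.ops_of_eq ?_))
    simp [runOps, Op.run, popMask]

/-- Clear the flag if the matrix contains a one. -/
def findOne : P := each popMat (.ops [.load fun v => { v with ok := v.ok && v.sym != .one }])

theorem takes_findOne (l : List Sym) :
    Takes findOne (⟨none, none, none, true⟩, contents [] [] l [] [] [] [] [] [])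
      (⟨none, none, none, l.all (· != .one)⟩, contents [] [] [] [] [] [] [] [] [])
      (l.length * 3 + 2) := by
  refine takes_each (fun done rem => (⟨rem.head?, none, none, done.all (· != .one)⟩,
    contents [] [] rem.tail [] [] [] [] [] [])) l 3 ?_ rfl ?_
  · simp [runOps, Op.run, popMat]
  · intro done a rem _
    refine Iter.single rfl ((Takes.ops_of_eq rfl).seq (Takes.ops_of_eq ?_))
    simp [runOps, Op.run, popMat, Reg.sym]

end MoralMachine

/-! ### Scanning the matrix against a mask -/

namespace MoralMachine

open StackProg

/-- Scan the row under inspection against the mask; `g` transforms the symbols, `h` updates the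
flag, `fin` is performed at the end of each row. -/
def scanBody (g : Option Sym → Option Sym → Sym → Sym) (h : Option Sym → Option Sym → Sym → Bool)
    (fin : List (Op Alph Reg)) : P :=
  .ite atEnd (.seq (.ops [.push .aux fun _ => .eor]) (.seq restoreMask (.ops fin)))
    (.seq (.ops [.pop .mask fun v x => { v with msk := x }])
      (.seq (.ite (fun v => v.msk.isSome) (.ops [.push .mask' fun v => v.msk.getD .zero]) (.ops []))
        (.ops [.push .aux fun v => g v.row v.msk v.sym,
          .load fun v => { v with msk := none, ok := v.ok && h v.row v.msk v.sym }])))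

section scan

variable (g : Option Sym → Option Sym → Sym → Sym) (h : Option Sym → Option Sym → Sym → Bool)
    (fin : List (Op Alph Reg))

/-- At column `k` the mask `T` is split between its stack and the reversed scratch copy. `T[k]?` is
`none` past the end of a mask shorter than the row, as happens in `stamp`. -/
theorem takes_scanBody_entry (x : Sym) (hx : x ≠ .eor) (row : Option Sym) (b : Bool)
    (T : List Sym) (k : ℕ) (m a r s c : List Sym) :
    Takes (scanBody g h fin)
      (⟨some x, none, row, b⟩, contents [] [] m a (T.drop k) (T.take k).reverse r s c)
      (⟨some x, none, row, b && h row T[k]? x⟩,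
        contents [] [] m (g row T[k]? x :: a) (T.drop (k + 1)) (T.take (k + 1)).reverse r s c)
      5 := by
  refine (Takes.ite_false (T := 1 + (2 + 1)) (by simpa [atEnd] using hx) ((Takes.ops_of_eq rfl).seq
    (Takes.seq (s' := (⟨some x, T[k]?, row, b⟩,
      contents [] [] m a (T.drop (k + 1)) (T.take (k + 1)).reverse r s c)) ?_
      (Takes.ops_of_eq ?_))))
  · simp only [runOps, Op.run, List.foldl_cons, List.foldl_nil, contents_mask, update_mask,
      List.head?_drop, List.tail_drop]
    rcases lt_or_ge k T.length with hk | hk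
    · refine Takes.ite_true (by simp [hk]) (Takes.ops_of_eq ?_)
      have htake : (T.take (k + 1)).reverse = T[k] :: (T.take k).reverse := by
        rw [List.take_add_one, List.getElem?_eq_getElem hk, Option.toList_some, List.reverse_append]
        rfl
      simp [runOps, Op.run, hk, htake]
    · refine Takes.ite_false (by simp [hk]) (Takes.ops_of_eq ?_)
      simp [runOps, hk, List.take_of_length_le, Nat.le_succ_of_le hk]
  · simp [runOps, Op.run, Reg.sym]

theorem iter_scan_entries (e rest : List Sym) (he : .eor ∉ e) (row : Option Sym) (b : Bool)
    (T a r s c : List Sym) :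
    Iter busy (.seq (scanBody g h fin) (.ops [popMat]))
      (⟨(e ++ .eor :: rest).head?, none, row, b⟩,
        contents [] [] (e ++ .eor :: rest).tail a T [] r s c)
      (⟨some .eor, none, row, b && (e.mapIdx fun j x => h row T[j]? x).all id⟩,
        contents [] [] rest ((e.mapIdx fun j x => g row T[j]? x).reverse ++ a)
          (T.drop e.length) (T.take e.length).reverse r s c) (e.length * 7) := by
  have := Iter.list (c := busy) (p := .seq (scanBody g h fin) (.ops [popMat]))
    (fun done rem => (⟨(rem ++ .eor :: rest).head?, none, row,
        b && (done.mapIdx fun j x => h row T[j]? x).all id⟩,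
      contents [] [] (rem ++ .eor :: rest).tail
        ((done.mapIdx fun j x => g row T[j]? x).reverse ++ a)
        (T.drop done.length) (T.take done.length).reverse r s c)) e 7 ?_
  · simpa using this
  · intro done x rem hl
    have hx : x ≠ .eor := by
      rintro rfl
      exact he (by simp [hl])
    refine Iter.single rfl ((takes_scanBody_entry g h fin x hx row _ T _ _ _ r s c).seq
      (Takes.ops_of_eq ?_))
    simp [runOps, Op.run, popMat, Bool.and_assoc]

/-- Each entry costs 7 steps for the scan and at most 3 for restoring the mask; the end of the row
costs 7 more. -/
theorem iter_scan_row (e rest : List Sym) (he : .eor ∉ e) (row : Option Sym) (b : Bool)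
    (T a r s c : List Sym) {s' : Reg × (∀ k, List (Alph k))}
    (hs' : runOps [popMat] (runOps fin (⟨none, none, row,
        b && (e.mapIdx fun j x => h row T[j]? x).all id⟩,
      contents [] [] rest (.eor :: (e.mapIdx fun j x => g row T[j]? x).reverse ++ a)
        T [] r s c)) = s') :
    Iter busy (.seq (scanBody g h fin) (.ops [popMat]))
      (⟨(e ++ .eor :: rest).head?, none, row, b⟩,
        contents [] [] (e ++ .eor :: rest).tail a T [] r s c) s' (e.length * 10 + 7) := by
  have h1 := takes_restoreMask (some .eor) row (b && (e.mapIdx fun j x => h row T[j]? x).all id)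
    rest (.eor :: (e.mapIdx fun j x => g row T[j]? x).reverse ++ a) (T.drop e.length)
    (T.take e.length) r s c
  rw [List.take_append_drop] at h1
  have h2 : Takes (.seq (scanBody g h fin) (.ops [popMat])) _ s' _ :=
    (Takes.ite_true (c := atEnd) (s := (⟨some .eor, none, row,
        b && (e.mapIdx fun j x => h row T[j]? x).all id⟩,
        contents [] [] rest ((e.mapIdx fun j x => g row T[j]? x).reverse ++ a)
          (T.drop e.length) (T.take e.length).reverse r s c)) rfl
      ((Takes.ops_of_eq (by simp [runOps, Op.run])).seq (h1.seq (Takes.ops_of_eq rfl)))).seq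
      (Takes.ops_of_eq hs')
  refine ((iter_scan_entries g h fin e rest he row b T a r s c).trans
    (Iter.single rfl h2)).mono ?_
  have : (T.take e.length).length ≤ e.length := by simp
  omega

end scan

/-- The stack contents that represent a list of rows. -/
def flat (rows : List (List Sym)) : List Sym := rows.flatMap (· ++ [.eor])

@[simp] theorem flat_nil : flat [] = [] := rfl

@[simp] theorem flat_cons (e : List Sym) (rows : List (List Sym)) :
    flat (e :: rows) = e ++ .eor :: flat rows := by simp [flat]

@[simp] theorem flat_append (rows rows' : List (List Sym)) :
    flat (rows ++ rows') = flat rows ++ flat rows' := by simp [flat]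

variable {n : ℕ}

/-- The rows of a square matrix. -/
def rowsOf (f : Fin n → Fin n → Sym) : List (List Sym) :=
  (List.finRange n).map fun i => (List.finRange n).map (f i)

theorem length_flat_map (f : Fin n → Fin n → Sym) (l : List (Fin n)) :
    (flat (l.map fun i => (List.finRange n).map (f i))).length = l.length * (n + 1) := by
  induction l with
  | nil => simp
  | cons i l ih => simp [ih, Nat.add_mul]; omega

theorem length_flat_rowsOf (f : Fin n → Fin n → Sym) :
    (flat (rowsOf f)).length = n * (n + 1) := by
  simp [rowsOf, length_flat_map]

theorem map_flat_rowsOf (g : Sym → Sym) (hg : g .eor = .eor) (f : Fin n → Fin n → Sym) :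
    (flat (rowsOf f)).map g = flat (rowsOf fun i j => g (f i j)) := by
  simp [flat, rowsOf, List.map_flatMap, List.flatMap_map, hg, Function.comp_def]

theorem finRange_eq_append {done rem : List (Fin n)} {i : Fin n}
    (h : List.finRange n = done ++ i :: rem) : done.length = i := by
  have h1 : (List.finRange n)[done.length]? = some i := by simp [h]
  rw [List.getElem?_eq_some_iff] at h1
  obtain ⟨h1, h2⟩ := h1
  rw [← h2]
  simp

/-- Write the diagonal symbols into the matrix; the mask contains the column to be stamped. -/
def stamp : P :=
  each popMat (scanBody (fun _ c e => if c = some .diag then .diag else e) (fun _ _ _ => true)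
    [.push .mask fun _ => .zero])

theorem mapIdx_map_finRange {β γ : Type} (f : Fin n → β) (g : ℕ → β → γ) :
    ((List.finRange n).map f).mapIdx g = (List.finRange n).map fun j : Fin n => g j (f j) := by
  apply List.ext_getElem <;> simp

theorem replicate_diag (k j : ℕ) :
    (List.replicate k Sym.zero ++ [.diag])[j]? = some .diag ↔ j = k := by
  rw [List.getElem?_append]
  split_ifs with hj
  · simp only [List.length_replicate] at hj
    simp [hj, hj.ne]
  · simp only [List.length_replicate, not_lt] at hj
    rcases hj.eq_or_lt with rfl | hj
    · simp
    · simp [hj.ne', List.getElem?_singleton]; omega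

/-- A zero is pushed onto the mask after each row, so in row `i` its only `diag` sits in column `i`.
-/
theorem takes_stamp (f : Fin n → Fin n → Sym) (hf : ∀ i j, f i j ≠ .eor) (c : List Sym) :
    Takes stamp (⟨none, none, none, true⟩, contents [] [] (flat (rowsOf f)) [] [.diag] [] [] [] c)
      (⟨none, none, none, true⟩, contents [] [] []
        (flat (rowsOf fun i j => if j = i then .diag else f i j)).reverse
        (List.replicate n .zero ++ [.diag]) [] [] [] c)
      (n * (n * 10 + 7) + 2) := by
  have := takes_each (o := popMat) (p := scanBody
      (fun _ c e => if c = some .diag then .diag else e) (fun _ _ _ => true)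
      [.push .mask fun _ => .zero])
    (s₀ := (⟨none, none, none, true⟩,
      contents [] [] (flat (rowsOf f)) [] [.diag] [] [] [] c))
    (fun done rem => (⟨(flat (rem.map fun i => (List.finRange n).map (f i))).head?, none, none,
        true⟩,
      contents [] [] (flat (rem.map fun i => (List.finRange n).map (f i))).tail
        (flat (done.map fun i => (List.finRange n).map fun j =>
          if j = i then .diag else f i j)).reverse
        (List.replicate done.length .zero ++ [.diag]) [] [] [] c)) (List.finRange n)
      (n * 10 + 7) ?_ rfl ?_
  · simpa [stamp, rowsOf] using this
  · simp [runOps, Op.run, popMat, rowsOf]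
  · intro done i rem hl
    have hi := finRange_eq_append hl
    simp only [List.map_cons, flat_cons]
    refine (iter_scan_row _ _ _ _ _ ?_ none true _ _ [] [] c ?_).mono (by simp)
    · simpa using fun j => hf i j
    · simp only [mapIdx_map_finRange, replicate_diag, hi]
      simp [runOps, Op.run, popMat, List.replicate_succ, Fin.ext_iff, hi]

/-- Mark the ones in rows and columns selected by the masks. -/
def markSym (m c : Option Sym) (e : Sym) : Sym :=
  if m ≠ some .zero ∧ c ≠ some .zero ∧ e = .one then .mark else e

/-- The entry is not a zero in a row and a column selected by the masks. -/
def okSym (m c : Option Sym) (e : Sym) : Bool :=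
  decide (m ≠ some .zero → c ≠ some .zero → e ≠ .zero)

/-- Mark the ones selected by the masks and check that no zero is selected. -/
def markMat : P :=
  each popMat (scanBody markSym okSym [.pop .rowMask fun v x => { v with row := x }])

/-- Both masks are copies of `r`: the column mask is rescanned in every row, while the row mask
yields one symbol per row, the first being preloaded in the register. -/
theorem takes_markMat (r : Fin n → Sym) (f : Fin n → Fin n → Sym) (hf : ∀ i j, f i j ≠ .eor)
    (s c : List Sym) :
    Takes markMat
      (⟨none, none, ((List.finRange n).map r).head?, true⟩,
        contents [] [] (flat (rowsOf f)) [] ((List.finRange n).map r) []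
          ((List.finRange n).map r).tail s c)
      (⟨none, none, none, (List.finRange n).all fun i => (List.finRange n).all fun j =>
          okSym (some (r i)) (some (r j)) (f i j)⟩,
        contents [] [] []
          (flat (rowsOf fun i j => markSym (some (r i)) (some (r j)) (f i j))).reverse
          ((List.finRange n).map r) [] [] s c)
      (n * (n * 10 + 7) + 2) := by
  have := takes_each (o := popMat) (p := scanBody markSym okSym
      [.pop .rowMask fun v x => { v with row := x }])
    (s₀ := (⟨none, none, ((List.finRange n).map r).head?, true⟩,
        contents [] [] (flat (rowsOf f)) [] ((List.finRange n).map r) []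
          ((List.finRange n).map r).tail s c))
    (fun done rem => (⟨(flat (rem.map fun i => (List.finRange n).map (f i))).head?, none,
        (rem.map r).head?, done.all fun i => (List.finRange n).all fun j =>
          okSym (some (r i)) (some (r j)) (f i j)⟩,
      contents [] [] (flat (rem.map fun i => (List.finRange n).map (f i))).tail
        (flat (done.map fun i => (List.finRange n).map fun j =>
          markSym (some (r i)) (some (r j)) (f i j))).reverse
        ((List.finRange n).map r) [] (rem.map r).tail s c)) (List.finRange n)
      (n * 10 + 7) ?_ rfl ?_
  · simpa [markMat, rowsOf] using this
  · simp [runOps, Op.run, popMat, rowsOf]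
  · intro done i rem hl
    simp only [List.map_cons, flat_cons]
    refine (iter_scan_row _ _ _ _ _ ?_ _ _ _ _ _ s c ?_).mono (by simp)
    · simpa using fun j => hf i j
    · simp only [mapIdx_map_finRange]
      simp [runOps, Op.run, popMat]

/-- Apply the mask collected in the scratch copy. -/
def applyMask : P :=
  .seq loadMasks (.seq (.ops [.pop .rowMask fun v x => { v with row := x }])
    (.seq markMat (.seq clearMask (.seq restoreMat (.ops [.load fun v => { v with ok := true }])))))

/-- The effect on a matrix of processing a mask. -/
def maskStep (r : Fin n → Sym) (f : Fin n → Fin n → Sym) (i j : Fin n) : Sym :=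
  resolve ((List.finRange n).all fun i => (List.finRange n).all fun j =>
    okSym (some (r i)) (some (r j)) (f i j)) (markSym (some (r i)) (some (r j)) (f i j))

theorem takes_applyMask (x : Option Sym) (r : Fin n → Sym) (f : Fin n → Fin n → Sym)
    (hf : ∀ i j, f i j ≠ .eor) (s c : List Sym) :
    Takes applyMask (⟨x, none, none, true⟩,
        contents [] [] (flat (rowsOf f)) [] [] ((List.finRange n).map r).reverse [] s c)
      (⟨none, none, none, true⟩, contents [] [] (flat (rowsOf (maskStep r f))) [] [] [] [] s c)
      (20 * (n + 1) ^ 2) := by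
  have h1 := takes_restoreMat ((List.finRange n).all fun i => (List.finRange n).all fun j =>
    okSym (some (r i)) (some (r j)) (f i j))
    (flat (rowsOf fun i j => markSym (some (r i)) (some (r j)) (f i j))) s c
  rw [map_flat_rowsOf _ rfl, length_flat_rowsOf] at h1
  refine ((takes_loadMasks x (flat (rowsOf f)) ((List.finRange n).map r) s c).seq
    ((Takes.ops_of_eq (by simp [runOps, Op.run])).seq ((takes_markMat r f hf s c).seq
      ((takes_clearMask _ _ _ _ _ _).seq (h1.seq (Takes.ops_of_eq rfl)))))).mono ?_
  simp only [List.length_map, List.length_finRange]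
  nlinarith

/-- Collect the rows of the snapshot and apply them as masks. -/
def applyRows : P := each popSnap (.ite atEnd applyMask (.ops [.push .mask' Reg.sym]))

theorem iter_collect (e rest : List Sym) (he : .eor ∉ e) (m c : List Sym) :
    Iter busy (.seq (.ite atEnd applyMask (.ops [.push .mask' Reg.sym])) (.ops [popSnap]))
      (⟨(e ++ .eor :: rest).head?, none, none, true⟩,
        contents [] [] m [] [] [] [] (e ++ .eor :: rest).tail c)
      (⟨some .eor, none, none, true⟩, contents [] [] m [] [] e.reverse [] rest c)
      (e.length * 4) := by
  have := Iter.list (c := busy)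
    (p := .seq (.ite atEnd applyMask (.ops [.push .mask' Reg.sym])) (.ops [popSnap]))
    (fun done rem => (⟨(rem ++ .eor :: rest).head?, none, none, true⟩,
      contents [] [] m [] [] done.reverse [] (rem ++ .eor :: rest).tail c)) e 4 ?_
  · simpa using this
  · intro done x rem hl
    have hx : x ≠ .eor := by
      rintro rfl
      exact he (by simp [hl])
    refine Iter.single rfl ((Takes.ite_false (by simpa [atEnd] using hx)
      (Takes.ops_of_eq rfl)).seq (Takes.ops_of_eq ?_))
    simp [runOps, Op.run, popSnap, Reg.sym]

/-- `F l` stands for the matrix after the rows in `l` have served as masks; its meaning in terms of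
graphs is supplied separately. -/
theorem takes_applyRows {n : ℕ} (F : List (Fin n) → Fin n → Fin n → Sym)
    (r : Fin n → Fin n → Sym) (hF : ∀ l i j, F l i j ≠ .eor) (hr : ∀ i j, r i j ≠ .eor)
    (hstep : ∀ l i, maskStep (r i) (F l) = F (l ++ [i])) (c : List Sym) :
    Takes applyRows (⟨none, none, none, true⟩,
        contents [] [] (flat (rowsOf (F []))) [] [] [] [] (flat (rowsOf r)) c)
      (⟨none, none, none, true⟩,
        contents [] [] (flat (rowsOf (F (List.finRange n)))) [] [] [] [] [] c)
      (26 * (n + 1) ^ 3) := by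
  have := takes_each (o := popSnap) (p := .ite atEnd applyMask (.ops [.push .mask' Reg.sym]))
    (s₀ := (⟨none, none, none, true⟩,
        contents [] [] (flat (rowsOf (F []))) [] [] [] [] (flat (rowsOf r)) c))
    (fun done rem => (⟨(flat (rem.map fun i => (List.finRange n).map (r i))).head?, none, none,
        true⟩,
      contents [] [] (flat (rowsOf (F done))) [] [] [] []
        (flat (rem.map fun i => (List.finRange n).map (r i))).tail c)) (List.finRange n)
      (24 * (n + 1) ^ 2) ?_ rfl ?_
  · refine Takes.mono (by simpa [applyRows] using this) ?_
    nlinarith [sq_nonneg (n + 1)]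
  · simp [runOps, Op.run, popSnap, rowsOf]
  · intro done i rem hl
    simp only [List.map_cons, flat_cons]
    refine ((iter_collect _ _ ?_ _ c).trans (Iter.single rfl
      ((Takes.ite_true rfl (takes_applyMask _ _ _ (hF done) _ c)).seq
        (Takes.ops_of_eq ?_)))).mono ?_
    · simpa using fun j => hr i j
    · simp [runOps, Op.run, popSnap, hstep]
    · simp only [List.length_map, List.length_finRange]
      nlinarith

end MoralMachine

/-! ### Rounds of eliminations -/

namespace SimpleGraph

variable {V : Type*}

/-- The closed neighbourhood of a vertex. -/
def closedNbhd (H : SimpleGraph V) (x : V) : Set V := {u | u = x ∨ H.Adj x u}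

/-- `H` with all edges inside `s` deleted. -/
def deleteInside (H : SimpleGraph V) (s : Set V) : SimpleGraph V where
  Adj u v := H.Adj u v ∧ ¬ (u ∈ s ∧ v ∈ s)
  symm := ⟨fun _ _ h => ⟨h.1.symm, fun h' => h.2 h'.symm⟩⟩
  loopless := ⟨fun _ h => h.1.ne rfl⟩

open Classical in
/-- Delete all edges inside `s` if `s` is a clique. -/
noncomputable def clearClique (H : SimpleGraph V) (s : Set V) : SimpleGraph V :=
  if H.IsClique s then H.deleteInside s else H

theorem clearClique_le (H : SimpleGraph V) (s : Set V) : H.clearClique s ≤ H := by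
  unfold clearClique
  split_ifs
  · exact fun _ _ h => h.1
  · exact le_rfl

theorem isClique_closedNbhd {H : SimpleGraph V} {x : V} :
    H.IsClique (H.closedNbhd x) ↔ H.IsClique (H.neighborSet x) := by
  constructor
  · exact fun h => h.subset fun u hu => Or.inr hu
  · rintro h u (rfl | hu) v (rfl | hv) huv
    · exact absurd rfl huv
    · exact hv
    · exact hu.symm
    · exact h hu hv huv

/-- A clique of `H` that is a closed neighbourhood in a larger graph is a closed neighbourhood in
`H`. -/
theorem closedNbhd_eq_of_isClique {H H₀ : SimpleGraph V} (hle : H ≤ H₀) {x : V}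
    (h : H.IsClique (H₀.closedNbhd x)) : H₀.closedNbhd x = H.closedNbhd x := by
  ext u
  constructor
  · rintro (rfl | hu)
    · exact Or.inl rfl
    · exact Or.inr (h (Or.inl rfl) (Or.inr hu) hu.ne)
  · rintro (rfl | hu)
    · exact Or.inl rfl
    · exact Or.inr (hle hu)

/-- By `closedNbhd_eq_of_isClique` a deletion guided by the older graph `H₀` is an elimination in
`H` itself. -/
theorem isMoral_clearClique_iff {H H₀ : SimpleGraph V} (h3 : H.IsSubcubic) (hle : H ≤ H₀) (x : V) :
    (H.clearClique (H₀.closedNbhd x)).IsMoral ↔ H.IsMoral := by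
  unfold clearClique
  split_ifs with h
  · have heq := closedNbhd_eq_of_isClique hle h
    rw [heq] at h ⊢
    rw [isClique_closedNbhd] at h
    exact ⟨.of_isolate h, .isolate h3 h⟩
  · rfl

theorem clearClique_lt {H : SimpleGraph V} {x y : V} (h : H.IsClique (H.neighborSet x))
    (hxy : H.Adj x y) : H.clearClique (H.closedNbhd x) < H := by
  refine lt_of_le_of_ne (clearClique_le _ _) fun heq => ?_
  rw [← heq, clearClique, if_pos (isClique_closedNbhd.2 h)] at hxy
  exact hxy.2 ⟨Or.inl rfl, Or.inr hxy.1⟩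

/-- Treat the closed neighbourhoods in `H₀` of the vertices of `l` one after the other. -/
noncomputable def clearAll (H₀ : SimpleGraph V) (l : List V) (H : SimpleGraph V) : SimpleGraph V :=
  l.foldl (fun H x => H.clearClique (H₀.closedNbhd x)) H

theorem clearAll_append (H₀ : SimpleGraph V) (l l' : List V) (H : SimpleGraph V) :
    H₀.clearAll (l ++ l') H = H₀.clearAll l' (H₀.clearAll l H) := by
  simp [clearAll]

theorem clearAll_le (H₀ : SimpleGraph V) (l : List V) (H : SimpleGraph V) :
    H₀.clearAll l H ≤ H := by
  induction l generalizing H with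
  | nil => exact le_rfl
  | cons x l ih => exact (ih _).trans (clearClique_le _ _)

theorem isMoral_clearAll_iff {H₀ H : SimpleGraph V} (h3 : H.IsSubcubic) (hle : H ≤ H₀)
    (l : List V) : (H₀.clearAll l H).IsMoral ↔ H.IsMoral := by
  induction l generalizing H with
  | nil => rfl
  | cons x l ih =>
    exact (ih (h3.mono (clearClique_le _ _)) ((clearClique_le _ _).trans hle)).trans
      (isMoral_clearClique_iff h3 hle x)

/-- Either an edge is lost before the turn of `x`, or the graph is still `H` then and the edge `xy`
is deleted. -/
theorem clearAll_lt {H : SimpleGraph V} {l : List V} {x y : V} (hx : x ∈ l)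
    (h : H.IsClique (H.neighborSet x)) (hxy : H.Adj x y) : H.clearAll l H < H := by
  obtain ⟨l₁, l₂, rfl⟩ := List.append_of_mem hx
  rw [clearAll_append]
  rcases (clearAll_le H l₁ H).lt_or_eq with hlt | heq
  · exact (clearAll_le _ _ _).trans_lt hlt
  · rw [heq]
    exact (clearAll_le H l₂ _).trans_lt (clearClique_lt h hxy)

variable {n : ℕ}

/-- One round of the elimination procedure. -/
noncomputable def elimRound (H : SimpleGraph (Fin n)) : SimpleGraph (Fin n) :=
  H.clearAll (List.finRange n) H

theorem elimRound_iterate_le (k : ℕ) (H : SimpleGraph (Fin n)) : elimRound^[k] H ≤ H := by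
  induction k generalizing H with
  | zero => exact le_rfl
  | succ k ih => exact (ih _).trans (clearAll_le _ _ _)

theorem isMoral_elimRound_iterate_iff {H : SimpleGraph (Fin n)} (h3 : H.IsSubcubic) (k : ℕ) :
    (elimRound^[k] H).IsMoral ↔ H.IsMoral := by
  induction k generalizing H with
  | zero => rfl
  | succ k ih =>
    exact (ih (h3.mono (clearAll_le _ _ _))).trans (isMoral_clearAll_iff h3 le_rfl _)

theorem elimRound_lt {H : SimpleGraph (Fin n)} (hH : H.IsMoral) (hne : H ≠ ⊥) :
    H.elimRound < H := by
  obtain ⟨u, v, huv⟩ := SimpleGraph.ne_bot_iff_exists_adj.1 hne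
  -- Restricting to non-isolated vertices yields a simplicial vertex whose elimination deletes an
  -- edge.
  obtain ⟨x, ⟨y, hxy⟩, hx⟩ := hH.exists_isClique_neighborSet (s := {x | ∃ y, H.Adj x y})
    ⟨u, v, huv⟩ fun a _ b hab => ⟨a, hab.symm⟩
  exact clearAll_lt (List.mem_finRange x) hx hxy

theorem elimRound_iterate_eq_bot {H : SimpleGraph (Fin n)} (h3 : H.IsSubcubic) (hH : H.IsMoral)
    {k : ℕ} (hk : H.edgeSet.ncard ≤ k) : elimRound^[k] H = ⊥ := by
  induction k generalizing H with
  | zero =>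
    have : H.edgeSet = ∅ := (Set.ncard_eq_zero (Set.toFinite _)).1 (by omega)
    simpa using this
  | succ k ih =>
    rw [Function.iterate_succ_apply]
    by_cases hne : H = ⊥
    · have := elimRound_iterate_le (k + 1) H
      rw [Function.iterate_succ_apply] at this
      subst hne
      exact le_bot_iff.1 this
    · have hlt := elimRound_lt hH hne
      have := Set.ncard_lt_ncard (edgeSet_ssubset_edgeSet.2 hlt) (Set.toFinite _)
      exact ih (h3.mono hlt.le) ((isMoral_elimRound_iterate_iff h3 1).2 hH) (by omega)

/-- Enough rounds lead to the graph without edges if and only if the graph is moral. -/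
theorem elimRound_iterate_eq_bot_iff {H : SimpleGraph (Fin n)} (h3 : H.IsSubcubic) {k : ℕ}
    (hk : n * n ≤ k) : elimRound^[k] H = ⊥ ↔ H.IsMoral := by
  constructor
  · intro h
    rw [← isMoral_elimRound_iterate_iff h3 k, h]
    exact isMoral_bot
  · intro hH
    refine elimRound_iterate_eq_bot h3 hH (le_trans ?_ hk)
    classical
    rw [← coe_edgeFinset, Set.ncard_coe_finset]
    refine H.card_edgeFinset_le_card_choose_two.trans ?_
    rw [Fintype.card_fin, Nat.choose_two_right]
    exact (Nat.div_le_self _ _).trans (Nat.mul_le_mul_left _ (Nat.sub_le _ _))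

end SimpleGraph

/-! ### Correctness and running time of the machine -/

namespace MoralMachine

open StackProg

variable {n : ℕ}

open Classical in
/-- The matrix that represents a graph on the working stacks. -/
noncomputable def symOf (H : SimpleGraph (Fin n)) (i j : Fin n) : Sym :=
  if j = i then .diag else if H.Adj i j then .one else .zero

theorem symOf_ne_eor (H : SimpleGraph (Fin n)) (i j : Fin n) : symOf H i j ≠ .eor := by
  unfold symOf
  split_ifs <;> simp

theorem symOf_ne_mark (H : SimpleGraph (Fin n)) (i j : Fin n) : symOf H i j ≠ .mark := by
  unfold symOf
  split_ifs <;> simp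

/-- Because the diagonal carries a nonzero symbol, row `i` used as a mask selects the closed
neighbourhood of `i`, and the clique test ignores the diagonal. -/
theorem symOf_eq_zero {H : SimpleGraph (Fin n)} {i j : Fin n} :
    symOf H i j = .zero ↔ j ∉ H.closedNbhd i := by
  unfold symOf SimpleGraph.closedNbhd
  split_ifs <;> simp_all

theorem symOf_eq_one {H : SimpleGraph (Fin n)} {i j : Fin n} :
    symOf H i j = .one ↔ H.Adj i j := by
  unfold symOf
  split_ifs with h h'
  · simp [h]
  · simpa using h'
  · simpa using h'

theorem symOf_congr {H H' : SimpleGraph (Fin n)} {i j : Fin n} (h : H.Adj i j ↔ H'.Adj i j) :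
    symOf H i j = symOf H' i j := by
  unfold symOf
  split_ifs <;> tauto

theorem resolve_symOf (b : Bool) (H : SimpleGraph (Fin n)) (i j : Fin n) :
    resolve b (symOf H i j) = symOf H i j := by
  have := symOf_ne_mark H i j
  generalize symOf H i j = e at this
  cases e <;> simp_all [resolve]

/-- The flag records whether the selected set is a clique: if so, the marked entries, which are the
edges inside it, become zeros; if not, they revert to ones. -/
theorem maskStep_symOf (H H₀ : SimpleGraph (Fin n)) (x : Fin n) :
    maskStep (symOf H₀ x) (symOf H) = symOf (H.clearClique (H₀.closedNbhd x)) := by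
  have hall : ((List.finRange n).all fun i => (List.finRange n).all fun j =>
      okSym (some (symOf H₀ x i)) (some (symOf H₀ x j)) (symOf H i j)) = true ↔
      H.IsClique (H₀.closedNbhd x) := by
    simp only [List.all_eq_true, List.mem_finRange, forall_true_left, okSym, decide_eq_true_eq,
      ne_eq, Option.some.injEq, symOf_eq_zero, not_not]
    constructor
    · exact fun h u hu v hv huv => (h u v hu hv).resolve_left huv.symm
    · intro h u v hu hv
      by_cases huv : v = u
      · exact Or.inl huv
      · exact Or.inr (h hu hv (Ne.symm huv))
  funext i j
  unfold maskStep
  set b := ((List.finRange n).all fun i => (List.finRange n).all fun j =>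
      okSym (some (symOf H₀ x i)) (some (symOf H₀ x j)) (symOf H i j)) with hb
  clear_value b
  have hsel : (some (symOf H₀ x i) ≠ some .zero ∧ some (symOf H₀ x j) ≠ some .zero ∧
      symOf H i j = .one) ↔ i ∈ H₀.closedNbhd x ∧ j ∈ H₀.closedNbhd x ∧ H.Adj i j := by
    simp only [ne_eq, Option.some.injEq, symOf_eq_zero, symOf_eq_one, not_not]
  unfold markSym
  by_cases hc : H.IsClique (H₀.closedNbhd x)
  · rw [SimpleGraph.clearClique, if_pos hc, hall.2 hc]
    split_ifs with h <;> rw [hsel] at h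
    · simp [resolve, symOf, h.2.2.ne', SimpleGraph.deleteInside, h.1, h.2.1]
    · rw [resolve_symOf]
      have : (H.deleteInside (H₀.closedNbhd x)).Adj i j ↔ H.Adj i j := by
        simp only [SimpleGraph.deleteInside]
        tauto
      exact symOf_congr this.symm
  · have hb' : b = false := by
      rw [← Bool.not_eq_true, hall]
      exact hc
    rw [SimpleGraph.clearClique, if_neg hc, hb']
    split_ifs with h <;> rw [hsel] at h
    · simp [resolve, symOf, h.2.2.ne', h.2.2]
    · rw [resolve_symOf]

/-- One round of the elimination procedure. -/
def round : P := .seq reverseMat (.seq snapshot applyRows)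

theorem takes_round (x : Option Sym) (H : SimpleGraph (Fin n)) (c : List Sym) :
    Takes MoralMachine.round
      (⟨x, none, none, true⟩, contents [] [] (flat (rowsOf (symOf H))) [] [] [] [] [] c)
      (⟨none, none, none, true⟩,
        contents [] [] (flat (rowsOf (symOf H.elimRound))) [] [] [] [] [] c)
      (36 * (n + 1) ^ 3) := by
  refine ((takes_reverseMat x _ c).seq ((takes_snapshot _ c).seq (takes_applyRows
    (fun l => symOf (H.clearAll l H)) (symOf H) (fun _ => symOf_ne_eor _) (symOf_ne_eor _)
    (fun l i => ?_) c))).mono ?_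
  · rw [maskStep_symOf, SimpleGraph.clearAll_append]
    rfl
  · rw [length_flat_rowsOf]
    nlinarith [Nat.zero_le (n ^ 3), Nat.zero_le (n ^ 2)]

/-- As many rounds as there are symbols on the counter stack. -/
def rounds : P := each popCnt MoralMachine.round

theorem takes_rounds (H : SimpleGraph (Fin n)) (c : List Sym) :
    Takes rounds
      (⟨none, none, none, true⟩, contents [] [] (flat (rowsOf (symOf H))) [] [] [] [] [] c)
      (⟨none, none, none, true⟩,
        contents [] [] (flat (rowsOf (symOf (SimpleGraph.elimRound^[c.length] H))))
          [] [] [] [] [] [])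
      (c.length * (38 * (n + 1) ^ 3) + 2) := by
  refine takes_each (fun done rem => (⟨rem.head?, none, none, true⟩,
    contents [] [] (flat (rowsOf (symOf (SimpleGraph.elimRound^[done.length] H))))
      [] [] [] [] [] rem.tail)) c (38 * (n + 1) ^ 3) ?_ rfl ?_
  · simp [runOps, Op.run, popCnt]
  · intro done a rem _
    refine (Iter.single rfl ((takes_round (some a) _ _).seq (Takes.ops_of_eq ?_))).mono ?_
    · simp [runOps, Op.run, popCnt, Function.iterate_succ_apply']
    · nlinarith [Nat.one_le_pow 3 (n + 1) (by omega)]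

/-- The elimination procedure, from reading the adjacency matrix to writing the answer. -/
def program : P :=
  .seq readInput (.seq restoreMat (.seq (.ops [.push .mask fun _ => .diag]) (.seq stamp
    (.seq clearMask (.seq restoreMat (.seq rounds (.seq findOne
      (.ops [.push .out Reg.ok, .load fun _ => ⟨none, none, none, true⟩]))))))))

theorem map_conv_encode (I : SubcubicGraph) : I.encode.map conv =
    flat (rowsOf fun i j => conv (some (decide (I.graph.Adj i j)))) := by
  simp [SubcubicGraph.encode, flat, rowsOf, List.ofFn_eq_map, List.map_flatten,
    List.flatMap_def, Function.comp_def, conv]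

theorem stamp_conv (I : SubcubicGraph) :
    (fun i j : Fin I.n => if j = i then Sym.diag else conv (some (decide (I.graph.Adj i j)))) =
      symOf I.graph := by
  funext i j
  unfold symOf
  by_cases h : I.graph.Adj i j <;> simp [h, conv]

theorem all_ne_one (H : SimpleGraph (Fin n)) :
    (flat (rowsOf (symOf H))).all (· != .one) = true ↔ H = ⊥ := by
  rw [← not_iff_not, ← ne_eq H, SimpleGraph.ne_bot_iff_exists_adj]
  simp [flat, rowsOf, symOf_eq_one]

theorem takes_program (I : SubcubicGraph) :
    Takes program (⟨none, none, none, true⟩, contents I.encode [] [] [] [] [] [] [] [])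
      (⟨none, none, none, true⟩, contents [] [I.morality] [] [] [] [] [] [] [])
      (100 * (I.encode.length + 1) ^ 5) := by
  have hlen : (I.encode.map conv).length = I.n * (I.n + 1) := by
    rw [map_conv_encode, length_flat_rowsOf]
  have hlen' : I.encode.length = I.n * (I.n + 1) := by simpa using hlen
  have h1 := takes_readInput I.encode
  -- The converted input contains no marks, so this transfer only undoes the reversal.
  have h2 := takes_restoreMat true (I.encode.map conv) [] (I.encode.map conv).reverse
  have hconv : (I.encode.map conv).map (resolve true) = I.encode.map conv := by
    rw [List.map_map]
    refine List.map_congr_left fun x _ => ?_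
    rcases x with _ | _ | _ <;> rfl
  rw [hconv] at h2
  have h3 := takes_stamp (fun i j : Fin I.n => conv (some (decide (I.graph.Adj i j))))
    (fun i j => by by_cases h : I.graph.Adj i j <;> simp [h, conv]) (I.encode.map conv).reverse
  rw [stamp_conv, ← map_conv_encode] at h3
  have h4 := takes_clearMask true [] (flat (rowsOf (symOf I.graph))).reverse
    (List.replicate I.n .zero ++ [.diag]) [] (I.encode.map conv).reverse
  have h5 := takes_restoreMat true (flat (rowsOf (symOf I.graph))) []
    (I.encode.map conv).reverse
  rw [map_flat_rowsOf _ rfl] at h5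
  simp only [resolve_symOf, length_flat_rowsOf] at h5
  have h6 := takes_rounds I.graph (I.encode.map conv).reverse
  have h7 := takes_findOne (flat (rowsOf (symOf
    (SimpleGraph.elimRound^[(I.encode.map conv).reverse.length] I.graph))))
  have hans : (flat (rowsOf (symOf (SimpleGraph.elimRound^[(I.encode.map conv).reverse.length]
      I.graph)))).all (· != .one) = I.morality := by
    -- The counter holds one symbol per input symbol, giving `n * (n + 1)` rounds, at least the
    -- required `n * n`.
    rw [Bool.eq_iff_iff, all_ne_one, List.length_reverse, hlen,
      SimpleGraph.elimRound_iterate_eq_bot_iff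
        (SimpleGraph.isSubcubic_of_maxDegree_le _ I.maxDegree_le)
        (Nat.mul_le_mul_left _ (Nat.le_succ _))]
    simp [SubcubicGraph.morality]
  rw [hans] at h7
  refine (h1.seq (h2.seq ((Takes.ops_of_eq (by simp [runOps, Op.run])).seq (h3.seq
    (h4.seq (h5.seq (h6.seq (h7.seq (Takes.ops_of_eq
      (by simp [runOps, Op.run])))))))))).mono ?_
  simp only [List.length_reverse, hlen, length_flat_rowsOf, hlen', List.length_append,
    List.length_replicate, List.length_singleton]
  -- All costs are bounded in terms of the input length `q`, using `n ≤ q`; the rounds dominate.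
  generalize hq : I.n * (I.n + 1) = q
  have hn : I.n ≤ q := hq ▸ Nat.le_mul_of_pos_right _ (Nat.succ_pos _)
  have hn' : I.n * (I.n * 10 + 7) ≤ 10 * q := by
    rw [← hq]
    nlinarith
  have hpow : q * (38 * (I.n + 1) ^ 3) ≤ 38 * (q + 1) ^ 5 := calc
    q * (38 * (I.n + 1) ^ 3) ≤ (q + 1) * (38 * (q + 1) ^ 3) := by gcongr; omega
    _ = 38 * (q + 1) ^ 4 := by ring
    _ ≤ 38 * (q + 1) ^ 5 := by gcongr <;> omega
  have hlin : q + 1 ≤ (q + 1) ^ 5 := Nat.le_self_pow (by omega) _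
  omega

theorem nonempty_tm2ComputableInPolyTime :
    Nonempty (Turing.TM2ComputableInPolyTime SubcubicGraph.encode Computability.encodeBool
      SubcubicGraph.morality) := by
  have hnil : (fun _ => [] : ∀ k, List (Alph k)) = contents [] [] [] [] [] [] [] [] [] := by
    funext k
    cases k <;> rfl
  refine program.nonempty_tm2ComputableInPolyTime (Γ := Alph) Stk.inp Stk.out
    ⟨none, none, none, true⟩ SubcubicGraph.encode Computability.encodeBool SubcubicGraph.morality
    (100 * (Polynomial.X + 1) ^ 5) fun I => ?_
  rw [hnil, update_inp, update_out]
  simpa [show ∀ b, Computability.encodeBool b = [b] from fun _ => rfl] using takes_program I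

end MoralMachine

theorem theorem3 :
    (∀ (V : Type*) [Fintype V] (G : SimpleGraph V) [DecidableRel G.Adj], G.maxDegree ≤ 3 →
      -- eliminating any simplicial vertex preserves morality
      (∀ x : V, (⊤ : G.Subgraph).IsSimplicial x → G.IsMoral →
        ((⊤ : G.Subgraph).eliminate x).coe.IsMoral) ∧
      -- every run of the elimination procedure stops after at most `|V|` rounds
      (∀ (k : ℕ) (H : G.Subgraph), G.ElimRun k H → k ≤ Fintype.card V) ∧
      -- a run that cannot be continued has reached the empty graph iff `G` is moral
      (∀ (k : ℕ) (H : G.Subgraph), G.ElimRun k H → (∀ x : V, ¬ H.IsSimplicial x) →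
        (H = ⊥ ↔ G.IsMoral))) ∧
    -- morality is decided by a Turing machine in polynomial time
    Nonempty (Turing.TM2ComputableInPolyTime SubcubicGraph.encode Computability.encodeBool
      SubcubicGraph.morality) := by
  refine ⟨fun V _ G _ hG => ?_, MoralMachine.nonempty_tm2ComputableInPolyTime⟩
  have h3 := G.isSubcubic_of_maxDegree_le hG
  refine ⟨fun x hx hmoral => ?_, fun k H h => ?_, fun k H h => h.eq_bot_iff h3⟩
  · rw [SimpleGraph.Subgraph.isMoral_coe_iff,
      (SimpleGraph.ElimRun.step .start hx).isMoral_iff h3]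
    exact hmoral
  · have := h.ncard_verts_add
    rw [Nat.card_eq_fintype_card] at this
    omega
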